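/- **Setting.** Let $n\ge 0$, let $f:\{0,1\}^n\to\{0,1\}$ be a base classifier, $x\in\{0,1\}^n$ and $p_+,p_-\in[0,1]$. Put $P_j=p_+$ if $x_j=0$ and $P_j=p_-$ if $x_j=1$. The smoothing distribution is $\phi(\tilde x\mid x)=\prod_j P_j^{\mathbf 1[\tilde x_j\ne x_j]}(1-P_j)^{\mathbf 1[\tilde x_j=x_j]}$, and the smooth classifier is $g(x)=\sum_{f(\tilde x)=1}\phi(\tilde x\mid x)$. The oracle is $O_f|b\rangle=(-1)^{f(b)}|b\rangle$. The distribution loader is $U=\bigotimes_m RY(\theta_0+x_m\theta_D)\,RX(x_m\pi)$ with $\theta_0=2\arccos\sqrt{1-p_+}$ and $\theta_D=-2(\arccos\sqrt{1-p_+}+\arccos\sqrt{1-p_-})$. Grover's operator is $G=U(2|0\rangle\langle 0|-I)U^{\dagger}O_f$. **The algorithm SQC** with $t$ counting qubits and confidence $1-\delta$, where $T=2^t$. One run of phase estimation applies $H^{\otimes t}\otimes U$ to $|0\rangle|0\rangle$, then for each counting qubit $k=0,\dots,t-1$ applies $2^k$ times the operator $G$ controlled by qubit $k$ (each controlled use of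 $O_f$ counts as one oracle call), then applies the inverse quantum Fourier transform to the counting register, and measures that register, obtaining $y\in\{0,\dots,T-1\}$. Its output is $\sin^2(\pi y/T)$, which is one of the numbers $a_j=\sin^2(\pi j/T)$, $0\le j\le T/2$. This is repeated independently $\lceil 17\ln(1/\delta)\rceil$ times. Let $a_i$ be the (lower) median of the outputs. SQC returns the estimate $\tilde a=a_i$, the lower bound $\underline g=a_{i-1}$ (or $a_0=0$ if $i=0$) and the upper bound $\overline g=a_{i+1}$ (or $1$ if $a_i$ is the largest of the $a_j$). **Lemma.** The number $t=t(\varepsilon)$ of counting qubits can be chosen as a function of $\varepsilon$ alone such that the following two statements hold. 1. For all $n,f,x$, all $p_+,p_-\in[0,1]$, all $\varepsilon>0$ and all $\delta\in(0,1)$, with probability at least $1-\delta$ all of the following hold simultaneously: $|\tilde a-g(x)|<\varepsilon$; $\underline g\le g(x)$ and $|\underline g-g(x)|<\varepsilon$; $g(x)\le\overline g$ and $|\overline g-g(x)|<\varepsilon$. 2. The total number of oracle calls is $O\!\left(\ln(1/\delta)\cdot\frac1\varepsilon\right)$: for every $\delta_0<1$ there is a constant $C$ such that for all $n,x$, all $p_+,p_-\in[0,1]$,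 all $\varepsilon\in(0,1]$ and all $\delta\in(0,\delta_0]$, SQC makes at most $C\,\ln(1/\delta)\cdot\frac1\varepsilon$ calls to $O_f$. -/

import Mathlib

open scoped Matrix Kronecker

noncomputable section

namespace SQC

/-! ### Discrete randomized smoothing -/

/-- Binary strings of length `n`; also the labels of the computational basis of `n` qubits. -/
abbrev Bits (n : ℕ) : Type := Fin n → Fin 2

/-- The probability of flipping a bit: `p₊` if it is `0`, and `p₋` if it is `1`. -/
def flipProb (pPlus pMinus : ℝ) (b : Fin 2) : ℝ := if b = 0 then pPlus else pMinus

/-- The probability `φ(x' | x; p₊, p₋)` of perturbing `x` to `x'`. -/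
def transProb {n : ℕ} (pPlus pMinus : ℝ) (x x' : Bits n) : ℝ :=
  ∏ j, if x' j = x j then 1 - flipProb pPlus pMinus (x j) else flipProb pPlus pMinus (x j)

/-- The smooth classifier `g(x) = ∑_{f(x') = 1} φ(x' | x)` of the base classifier `f`. -/
def smooth {n : ℕ} (pPlus pMinus : ℝ) (f : Bits n → Fin 2) (x : Bits n) : ℝ :=
  ∑ x' with f x' = 1, transProb pPlus pMinus x x'

/-! ### Elementary unitaries -/

/-- The rotation `RX(θ)` of one qubit. -/
def rx (θ : ℝ) : Matrix (Fin 2) (Fin 2) ℂ :=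
  !![(Real.cos (θ / 2) : ℂ), -Complex.I * Real.sin (θ / 2);
     -Complex.I * Real.sin (θ / 2), (Real.cos (θ / 2) : ℂ)]

/-- The rotation `RY(θ)` of one qubit. -/
def ry (θ : ℝ) : Matrix (Fin 2) (Fin 2) ℂ :=
  !![(Real.cos (θ / 2) : ℂ), -(Real.sin (θ / 2) : ℂ);
     (Real.sin (θ / 2) : ℂ), (Real.cos (θ / 2) : ℂ)]

/-- The Hadamard gate. -/
def hadamard : Matrix (Fin 2) (Fin 2) ℂ :=
  ((Real.sqrt 2)⁻¹ : ℂ) • !![1, 1; 1, -1]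

lemma rx_mem (θ : ℝ) : rx θ ∈ Matrix.unitaryGroup (Fin 2) ℂ := by
  have h : (Real.cos (θ / 2) : ℂ) ^ 2 + (Real.sin (θ / 2) : ℂ) ^ 2 = 1 := by
    exact_mod_cast Real.cos_sq_add_sin_sq (θ / 2)
  rw [Matrix.mem_unitaryGroup_iff]
  ext i j
  fin_cases i <;> fin_cases j <;>
    simp [rx, Matrix.mul_apply, Fin.sum_univ_two, Matrix.star_apply, -Complex.ofReal_cos,
      -Complex.ofReal_sin] <;>
    (try (ring_nf; done)) <;> linear_combination h - (Real.sin (θ / 2) : ℂ) ^ 2 * Complex.I_sq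

lemma ry_mem (θ : ℝ) : ry θ ∈ Matrix.unitaryGroup (Fin 2) ℂ := by
  have h : (Real.cos (θ / 2) : ℂ) ^ 2 + (Real.sin (θ / 2) : ℂ) ^ 2 = 1 := by
    exact_mod_cast Real.cos_sq_add_sin_sq (θ / 2)
  rw [Matrix.mem_unitaryGroup_iff]
  ext i j
  fin_cases i <;> fin_cases j <;>
    simp [ry, Matrix.mul_apply, Fin.sum_univ_two, Matrix.star_apply, -Complex.ofReal_cos,
      -Complex.ofReal_sin] <;>
    (try (ring_nf; done)) <;> linear_combination h

lemma hadamard_mem : hadamard ∈ Matrix.unitaryGroup (Fin 2) ℂ := by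
  have h : ((Real.sqrt 2)⁻¹ : ℂ) ^ 2 = 1 / 2 := by
    rw [inv_pow]
    norm_cast
    rw [Real.sq_sqrt (by norm_num)]
    norm_num
  rw [Matrix.mem_unitaryGroup_iff]
  ext i j
  fin_cases i <;> fin_cases j <;>
    simp [hadamard, Matrix.mul_apply, Fin.sum_univ_two, Matrix.star_apply] <;>
    ring_nf <;> (try (rw [h]; norm_num))

/-- The tensor product of one-qubit operators `V 0, …, V (n - 1)`. -/
def tensor {n : ℕ} (V : Fin n → Matrix (Fin 2) (Fin 2) ℂ) : Matrix (Bits n) (Bits n) ℂ :=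
  Matrix.of fun a b => ∏ j, V j (a j) (b j)

lemma tensor_mem {n : ℕ} {V : Fin n → Matrix (Fin 2) (Fin 2) ℂ}
    (hV : ∀ j, V j ∈ Matrix.unitaryGroup (Fin 2) ℂ) :
    tensor V ∈ Matrix.unitaryGroup (Bits n) ℂ := by
  rw [Matrix.mem_unitaryGroup_iff]
  ext a b
  have h : ∀ j, ∑ c : Fin 2, V j (a j) c * star (V j (b j) c) = if a j = b j then 1 else 0 := by
    intro j
    have := congrFun (congrFun (Matrix.mem_unitaryGroup_iff.1 (hV j)) (a j)) (b j)
    simpa [Matrix.mul_apply, Matrix.star_apply, Matrix.one_apply] using this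
  have e : (tensor V * star (tensor V)) a b
      = ∏ j, ∑ c : Fin 2, V j (a j) c * star (V j (b j) c) := by
    rw [Finset.prod_univ_sum]
    simp [tensor, Matrix.mul_apply, Matrix.star_apply, Finset.prod_mul_distrib]
  rw [e, Matrix.one_apply]
  simp only [h]
  by_cases hab : a = b
  · subst hab; simp
  · rw [if_neg hab]
    obtain ⟨j, hj⟩ := Function.ne_iff.1 hab
    exact Finset.prod_eq_zero (Finset.mem_univ j) (if_neg hj)

lemma diagonal_mem {ι : Type*} [Fintype ι] [DecidableEq ι] {d : ι → ℂ}
    (hd : ∀ i, d i * star (d i) = 1) : Matrix.diagonal d ∈ Matrix.unitaryGroup ι ℂ := by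
  rw [Matrix.mem_unitaryGroup_iff, Matrix.star_eq_conjTranspose, Matrix.diagonal_conjTranspose,
    Matrix.diagonal_mul_diagonal, ← Matrix.diagonal_one]
  congr 1
  funext i
  exact hd i

/-- The distribution loader
`U(x, p₋, p₊) = ⊗ₘ RY(θ₀ + xₘ θ_D) RX(xₘ π)` on `n` qubits, where
`θ₀ = 2 arccos √(1 - p₊)` and `θ_D = -2 (arccos √(1 - p₊) + arccos √(1 - p₋))`. -/
def loader {n : ℕ} (pPlus pMinus : ℝ) (x : Bits n) : Matrix.unitaryGroup (Bits n) ℂ :=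
  ⟨tensor fun m =>
      ry (2 * Real.arccos (Real.sqrt (1 - pPlus)) + ((x m : ℕ) : ℝ) *
        (-2 * (Real.arccos (Real.sqrt (1 - pPlus)) + Real.arccos (Real.sqrt (1 - pMinus))))) *
      rx (((x m : ℕ) : ℝ) * Real.pi),
    tensor_mem fun _ => mul_mem (ry_mem _) (rx_mem _)⟩

/-- The reflection `R₀ = 2 |0⟩⟨0| - 1`, which is the diagonal operator that fixes `|0⟩` and
changes the sign of every other basis state. -/
def reflZero (n : ℕ) : Matrix.unitaryGroup (Bits n) ℂ :=
  ⟨Matrix.diagonal fun b => if b = 0 then 1 else -1,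
    diagonal_mem fun b => by split_ifs <;> simp⟩

/-- The reflection `U R₀ U†` about the state `U |0⟩`, where `U` is the distribution loader. -/
def reflPsi {n : ℕ} (pPlus pMinus : ℝ) (x : Bits n) : Matrix.unitaryGroup (Bits n) ℂ :=
  loader pPlus pMinus x * reflZero n * (loader pPlus pMinus x)⁻¹

/-- The phase oracle `O_f |b⟩ = (-1)^{f(b)} |b⟩` of the base classifier `f`. -/
def oracle {n : ℕ} (f : Bits n → Fin 2) : Matrix.unitaryGroup (Bits n) ℂ :=
  ⟨Matrix.diagonal fun b => (-1) ^ (f b : ℕ),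
    diagonal_mem fun b => by
      rcases neg_one_pow_eq_or ℂ (f b : ℕ) with h | h <;> simp [h]⟩

/-! ### Query circuits on `t` counting qubits and `n` data qubits -/

/-- Basis labels of the joint register: a counting string and a data string. -/
abbrev Reg (t n : ℕ) : Type := Bits t × Bits n

/-- The operator `V` on the data register, controlled by the `k`-th counting qubit:
`|y⟩|b⟩ ↦ |y⟩ V|b⟩` if `y k = 1`, and `|y⟩|b⟩ ↦ |y⟩|b⟩` if `y k = 0`. -/
def controlled {t n : ℕ} (k : Fin t) (V : Matrix.unitaryGroup (Bits n) ℂ) :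
    Matrix.unitaryGroup (Reg t n) ℂ :=
  ⟨Matrix.of fun p q =>
      if p.1 = q.1 then (if p.1 k = 1 then V.1 p.2 q.2 else (1 : Matrix _ _ ℂ) p.2 q.2) else 0, by
    rw [Matrix.mem_unitaryGroup_iff]
    ext ⟨y, a⟩ ⟨z, b⟩
    have hV := congrFun (congrFun (Matrix.mem_unitaryGroup_iff.1 V.2) a) b
    rw [Matrix.mul_apply] at hV
    simp only [Matrix.star_apply] at hV
    rw [Matrix.mul_apply, Fintype.sum_prod_type, Finset.sum_eq_single y]
    · by_cases hyz : y = z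
      · subst hyz
        by_cases hk : y k = 1
        · simpa [Matrix.star_apply, hk, Matrix.one_apply] using hV
        · simp only [Matrix.of_apply, Matrix.star_apply, hk, if_true, if_false, Matrix.one_apply,
            Prod.mk.injEq, true_and, apply_ite star, star_one, star_zero]
          simp
      · simp [Matrix.star_apply, hyz, Matrix.one_apply, Ne.symm hyz]
    · intro w _ hw
      simp [Ne.symm hw]
    · simp⟩

/-- The integer `∑ₖ yₖ 2ᵏ` that is encoded by a counting string. -/
def value {t : ℕ} (y : Bits t) : ℕ := (finFunctionFinEquiv y : Fin (2 ^ t))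

/-- The inverse quantum Fourier transform
`|y⟩ ↦ T^{-1/2} ∑_z exp(-2πi y z / T) |z⟩` on the counting register, with `T = 2ᵗ`. -/
def iqft (t : ℕ) : Matrix (Bits t) (Bits t) ℂ :=
  Matrix.of fun z y =>
    ((Real.sqrt (2 ^ t))⁻¹ : ℂ) *
      Complex.exp (-(2 * Real.pi * Complex.I * value y * value z / 2 ^ t))

lemma iqft_mem (t : ℕ) : iqft t ∈ Matrix.unitaryGroup (Bits t) ℂ := by
  have hT : (2 ^ t : ℂ) ≠ 0 := pow_ne_zero _ two_ne_zero
  have hs : ((Real.sqrt (2 ^ t))⁻¹ : ℂ) * ((Real.sqrt (2 ^ t))⁻¹ : ℂ) = (2 ^ t : ℂ)⁻¹ := by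
    rw [← mul_inv]
    rw [← Complex.ofReal_mul, Real.mul_self_sqrt (by positivity)]
    push_cast
    rfl
  rw [Matrix.mem_unitaryGroup_iff]
  ext a b
  set w : ℂ := Complex.exp (2 * Real.pi * Complex.I * ((value b : ℂ) - value a) / 2 ^ t) with hw
  have hterm : ∀ c : Bits t, iqft t a c * star (iqft t b c) = (2 ^ t : ℂ)⁻¹ * w ^ value c := by
    intro c
    have hstar : star (iqft t b c) = ((Real.sqrt (2 ^ t))⁻¹ : ℂ) *
        Complex.exp (2 * Real.pi * Complex.I * value c * value b / 2 ^ t) := by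
      have h2 : (starRingEnd ℂ) 2 = 2 := Complex.conj_ofNat 2
      simp [iqft, ← Complex.exp_conj, Complex.conj_ofReal, h2, neg_div]
    rw [hstar, hw, ← Complex.exp_nat_mul, ← hs]
    simp only [iqft, Matrix.of_apply]
    rw [mul_mul_mul_comm, ← Complex.exp_add]
    congr 2
    ring
  have hsum : (iqft t * star (iqft t)) a b
      = (2 ^ t : ℂ)⁻¹ * ∑ j ∈ Finset.range (2 ^ t), w ^ j := by
    rw [Matrix.mul_apply]
    simp only [Matrix.star_apply, hterm]
    rw [← Finset.mul_sum, ← Fin.sum_univ_eq_sum_range (fun j => w ^ j),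
      ← Equiv.sum_comp finFunctionFinEquiv]
    rfl
  rw [hsum, Matrix.one_apply]
  by_cases hab : a = b
  · subst hab
    simp [hw]
  · rw [if_neg hab]
    have hne : w ≠ 1 := by
      intro h1
      obtain ⟨k, hk⟩ := Complex.exp_eq_one_iff.1 h1
      have h2 : (2 * Real.pi * Complex.I : ℂ) ≠ 0 := Complex.two_pi_I_ne_zero
      have h3 : ((value b : ℂ) - value a) = k * 2 ^ t := by
        field_simp at hk
        rw [hk, mul_comm]
      have h4 : (value b : ℤ) - value a = k * 2 ^ t := by exact_mod_cast h3
      have hva : (value a : ℤ) < 2 ^ t := by exact_mod_cast (finFunctionFinEquiv a).2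
      have hvb : (value b : ℤ) < 2 ^ t := by exact_mod_cast (finFunctionFinEquiv b).2
      have hk0 : k = 0 := by
        have hp : (0 : ℤ) < 2 ^ t := by positivity
        have : k < 1 := by nlinarith
        have : -1 < k := by nlinarith
        omega
      apply hab
      apply finFunctionFinEquiv.injective
      apply Fin.ext
      have : (value b : ℤ) = value a := by rw [hk0] at h4; linarith
      exact_mod_cast this.symm
    have hpow : w ^ (2 ^ t) = 1 := by
      rw [hw, ← Complex.exp_nat_mul, Complex.exp_eq_one_iff]
      refine ⟨(value b : ℤ) - value a, ?_⟩
      push_cast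
      field_simp
    have hz := mul_geom_sum w (2 ^ t)
    rw [hpow, sub_self] at hz
    rw [(mul_eq_zero.1 hz).resolve_left (sub_ne_zero.2 hne), mul_zero]

/-- The unitary `A ⊗ B` on the joint register. -/
def both {t n : ℕ} (A : Matrix.unitaryGroup (Bits t) ℂ) (B : Matrix.unitaryGroup (Bits n) ℂ) :
    Matrix.unitaryGroup (Reg t n) ℂ :=
  ⟨A.1 ⊗ₖ B.1, Matrix.kronecker_mem_unitary A.2 B.2⟩

/-- A gate of a query circuit: a unitary that is fixed in advance and cannot depend on the base
classifier, or one call to the oracle, controlled by a counting qubit. -/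
inductive Gate (t n : ℕ) : Type
  | free (V : Matrix.unitaryGroup (Reg t n) ℂ)
  | query (k : Fin t)

/-- The unitary of a gate when the oracle is that of `f`. -/
def Gate.unitary {t n : ℕ} (f : Bits n → Fin 2) : Gate t n → Matrix.unitaryGroup (Reg t n) ℂ
  | .free V => V
  | .query k => controlled k (oracle f)

/-- The number of oracle calls that a gate makes. -/
def Gate.calls {t n : ℕ} : Gate t n → ℕ
  | .free _ => 0
  | .query _ => 1

/-- The unitary of a circuit; the head of the list is applied first. -/
def circuitUnitary {t n : ℕ} (f : Bits n → Fin 2) :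
    List (Gate t n) → Matrix.unitaryGroup (Reg t n) ℂ
  | [] => 1
  | G :: C => circuitUnitary f C * G.unitary f

/-- The number of oracle calls that a circuit makes. -/
def circuitCalls {t n : ℕ} (C : List (Gate t n)) : ℕ := (C.map Gate.calls).sum

/-- The Born rule: run the circuit on `|0⟩|0⟩` and measure the counting register. -/
def measure {t n : ℕ} (f : Bits n → Fin 2) (C : List (Gate t n)) : PMF (Bits t) :=
  PMF.ofFintype
    (fun y => ENNReal.ofReal (∑ b : Bits n, ‖(circuitUnitary f C).1 (y, b) (0, 0)‖ ^ 2)) (by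
      rw [← ENNReal.ofReal_sum_of_nonneg (fun _ _ => by positivity), ← Fintype.sum_prod_type
        (f := fun p : Reg t n => ‖(circuitUnitary f C).1 p (0, 0)‖ ^ 2)]
      have h := congrFun (congrFun
        (Matrix.mem_unitaryGroup_iff'.1 (circuitUnitary f C).2) (0, 0)) (0, 0)
      rw [Matrix.mul_apply, Matrix.one_apply_eq] at h
      simp only [Matrix.star_apply, RCLike.star_def, Complex.conj_mul'] at h
      have h' : ∑ p : Reg t n, ‖(circuitUnitary f C).1 p (0, 0)‖ ^ 2 = 1 := by exact_mod_cast h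
      rw [h', ENNReal.ofReal_one])

/-! ### The algorithm -/

/-- The phase estimation circuit with `t` counting qubits for Grover's operator
`G = (U R₀ U†) O_f`: apply `H^{⊗t} ⊗ U`; for each counting qubit `k`, apply `2ᵏ` times the
operator `G` controlled by `k`; then apply the inverse quantum Fourier transform. -/
def phaseCircuit {n : ℕ} (t : ℕ) (pPlus pMinus : ℝ) (x : Bits n) : List (Gate t n) :=
  [Gate.free (both ⟨tensor fun _ => hadamard, tensor_mem fun _ => hadamard_mem⟩
      (loader pPlus pMinus x))] ++
  (List.finRange t).flatMap (fun k : Fin t => (List.replicate (2 ^ (k : ℕ))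
      [Gate.query k, Gate.free (controlled k (reflPsi pPlus pMinus x))]).flatten) ++
  [Gate.free (both ⟨iqft t, iqft_mem t⟩ 1)]

/-- The number `⌈17 ln (1/δ)⌉` of repetitions of phase estimation. -/
def reps (δ : ℝ) : ℕ := ⌈17 * Real.log (1 / δ)⌉₊

/-- The joint law of the outcomes of the independent runs of the phase estimation circuit. -/
def runs {n : ℕ} (t : ℕ) (δ pPlus pMinus : ℝ) (f : Bits n → Fin 2) (x : Bits n) :
    MeasureTheory.Measure (Fin (reps δ) → Bits t) :=
  MeasureTheory.Measure.pi fun _ => (measure f (phaseCircuit t pPlus pMinus x)).toMeasure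

/-- The total number of oracle calls of the algorithm. -/
def totalCalls {n : ℕ} (t : ℕ) (δ pPlus pMinus : ℝ) (x : Bits n) : ℕ :=
  reps δ * circuitCalls (phaseCircuit t pPlus pMinus x)

/-- The possible outputs `a_j = sin² (π j / T)`, where `T = 2ᵗ` and `0 ≤ j ≤ T / 2`, in increasing
order; a larger index is cut off at `T / 2`, where the value is `1`. -/
def gridValue (t j : ℕ) : ℝ := Real.sin (Real.pi * min ((j : ℝ) / 2 ^ t) (1 / 2)) ^ 2

/-- The index of the output `sin² (π y / T)` in the list `a_0 ≤ a_1 ≤ …`; the measured integers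
`y` and `T - y` give the same output. -/
def gridIndex {t : ℕ} (y : Bits t) : ℕ := min (value y) (2 ^ t - value y)

/-- The median of finitely many natural numbers (the lower one of the two middle entries if their
number is even). -/
def median {N : ℕ} (v : Fin N → ℕ) : ℕ :=
  ((List.ofFn v).mergeSort (fun a b => decide (a ≤ b))).getD ((N - 1) / 2) 0

/-- The median index of the measured outputs. -/
def medianIndex {N t : ℕ} (ω : Fin N → Bits t) : ℕ := median fun i => gridIndex (ω i)

/-- The estimate of `g(x)`: the median `a_i` of the measured outputs. -/
def estimate {N t : ℕ} (ω : Fin N → Bits t) : ℝ := gridValue t (medianIndex ω)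

/-- The lower bound for `g(x)`: the possible output `a_{i-1}` just below the median `a_i`
(or `a_0 = 0` if `i = 0`). -/
def lowerBound {N t : ℕ} (ω : Fin N → Bits t) : ℝ := gridValue t (medianIndex ω - 1)

/-- The upper bound for `g(x)`: the possible output `a_{i+1}` just above the median `a_i`
(or `1` if `a_i` is the largest one). -/
def upperBound {N t : ℕ} (ω : Fin N → Bits t) : ℝ := gridValue t (medianIndex ω + 1)

end SQC

end

open scoped Matrix Kronecker

/-! ### The Fejér kernel -/

namespace SQC

/-! Write g(x) = sin²θ with 0 ≤ θ ≤ π/2, and put T = 2^t, w = Tθ/π. The loader prepares ψ = U|0⟩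
with |ψ_b|² = φ(b | x) (`norm_loaded_sq`), so the part of ψ on {f = 1} has weight sin²θ. Grover's
operator rotates by 2θ in the plane of the two parts of ψ (`grover_pow_mulVec_loaded`); its
eigenphases there are ±2θ. Hence the law of a measured y is the average of two Fejér kernels,
centred at w and −w (`measure_phaseCircuit_apply`).

Each kernel puts mass at least 7/10 on the residues of the integers within 1 of its centre
(`sum_fejer_ge`). Folding y with T − y merges the two centres, so one run yields an index within 1
of w with probability at least 7/10. The median leaves this window only if at least half of the runs
do, which has probability at most (11/12)^N ≤ δ (`measureReal_majority_fail_le`, `pow_reps_le`).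

If the median index i is within 1 of w, then a_{i−1} and a_{i+1} enclose g(x), and all indices
involved are within 2 of w. As sin² is 1-Lipschitz, the errors are at most 2π/T, which is below ε
once T ≥ 14/ε. One run makes T − 1 oracle calls, which is O(1/ε). -/

/-- The Fejér kernel `|T⁻¹ ∑_{m < T} exp (2πi m u / T)|²`. -/
noncomputable def fejer (T : ℕ) (u : ℝ) : ℝ :=
  ‖(T : ℂ)⁻¹ * ∑ m ∈ Finset.range T, Complex.exp (2 * Real.pi * Complex.I * m * u / T)‖ ^ 2

lemma fejer_nonneg (T : ℕ) (u : ℝ) : 0 ≤ fejer T u := sq_nonneg _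

lemma fejer_zero {T : ℕ} (hT : T ≠ 0) : fejer T 0 = 1 := by
  simp [fejer, hT]

lemma fejer_add_int_mul {T : ℕ} (hT : T ≠ 0) (u : ℝ) (k : ℤ) :
    fejer T (u + k * T) = fejer T u := by
  have hT' : (T : ℂ) ≠ 0 := by exact_mod_cast hT
  unfold fejer
  congr 3
  refine Finset.sum_congr rfl fun m _ => ?_
  rw [Complex.exp_eq_exp_iff_exists_int]
  refine ⟨m * k, ?_⟩
  push_cast
  field_simp

/-- Summing the geometric series gives |w^T − 1| = |w − 1| · |∑ w^m|, where the left side is 2|sin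
πu| and |w − 1| ≤ 2π|u|/T. The product form avoids a case distinction at u = 0. -/
lemma sin_sq_le_fejer {T : ℕ} (hT : T ≠ 0) (u : ℝ) :
    Real.sin (Real.pi * u) ^ 2 ≤ fejer T u * (Real.pi * u) ^ 2 := by
  have hTc : (T : ℂ) ≠ 0 := by exact_mod_cast hT
  have hT' : (0 : ℝ) < T := by exact_mod_cast Nat.pos_of_ne_zero hT
  set w : ℂ := Complex.exp (Complex.I * ((2 * Real.pi * u / T : ℝ) : ℂ)) with hw
  have hs : ∑ m ∈ Finset.range T, Complex.exp (2 * Real.pi * Complex.I * m * u / T)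
      = ∑ m ∈ Finset.range T, w ^ m := by
    refine Finset.sum_congr rfl fun m _ => ?_
    rw [hw, ← Complex.exp_nat_mul]
    congr 1
    push_cast
    ring
  have hpow : w ^ T = Complex.exp (Complex.I * ((2 * Real.pi * u : ℝ) : ℂ)) := by
    rw [hw, ← Complex.exp_nat_mul]
    congr 1
    push_cast
    field_simp
  have h1 : ‖w - 1‖ ≤ 2 * |Real.pi * u| / T := by
    have := Real.norm_exp_I_mul_ofReal_sub_one_le (x := 2 * Real.pi * u / T)
    rw [← hw] at this
    refine this.trans (le_of_eq ?_)
    rw [Real.norm_eq_abs, abs_div, mul_assoc, abs_mul, abs_of_pos hT', abs_two]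
  have h2 : ‖w ^ T - 1‖ = 2 * |Real.sin (Real.pi * u)| := by
    rw [hpow, Complex.norm_exp_I_mul_ofReal_sub_one, norm_mul, Real.norm_eq_abs, Real.norm_eq_abs,
      abs_two]
    congr 3
    ring
  have h3 : ‖w ^ T - 1‖ = ‖w - 1‖ * ‖∑ m ∈ Finset.range T, w ^ m‖ := by
    rw [← norm_mul, mul_geom_sum]
  have h4 : |Real.sin (Real.pi * u)| ≤
      ‖(T : ℂ)⁻¹ * ∑ m ∈ Finset.range T, w ^ m‖ * |Real.pi * u| := by
    rw [norm_mul, norm_inv, Complex.norm_natCast]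
    have h5 := mul_le_mul_of_nonneg_right h1 (norm_nonneg (∑ m ∈ Finset.range T, w ^ m))
    rw [← h3, h2] at h5
    calc |Real.sin (Real.pi * u)| = (2 * |Real.sin (Real.pi * u)|) / 2 := by ring
      _ ≤ (2 * |Real.pi * u| / T * ‖∑ m ∈ Finset.range T, w ^ m‖) / 2 := by gcongr
      _ = _ := by ring
  unfold fejer
  rw [hs, ← sq_abs (Real.sin _), ← sq_abs (Real.pi * u), ← mul_pow]
  gcongr

lemma fejer_ge_of_abs_le_quarter {T : ℕ} (hT : T ≠ 0) {u : ℝ} (hu : |u| ≤ 1 / 4) :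
    7 / 10 ≤ fejer T u := by
  rcases eq_or_ne u 0 with rfl | h0
  · rw [fejer_zero hT]; norm_num
  have hpos : 0 < |u| := abs_pos.2 h0
  set x := Real.pi * |u| with hx
  have hxpos : 0 < x := mul_pos Real.pi_pos hpos
  have hx1 : x ≤ 4 / 5 := by
    have := Real.pi_lt_d2
    nlinarith
  have hsin := Real.sin_gt_sub_cube hxpos
  have hsq : Real.sin x ^ 2 = Real.sin (Real.pi * u) ^ 2 := by
    rcases abs_choice u with h | h <;> simp [hx, h]
  have hxq : (Real.pi * u) ^ 2 = x ^ 2 := by rw [hx, mul_pow, mul_pow, sq_abs]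
  have h := sin_sq_le_fejer hT u
  rw [← hsq, hxq] at h
  have h1 : x * (1 - x ^ 2 / 6) ≤ Real.sin x := by nlinarith
  have h2 : (8 / 9 : ℝ) ≤ 1 - x ^ 2 / 6 := by nlinarith
  have h3 : (x * (8 / 9)) ^ 2 ≤ Real.sin x ^ 2 :=
    pow_le_pow_left₀ (by positivity) ((mul_le_mul_of_nonneg_left h2 hxpos.le).trans h1) 2
  have h4 : (64 / 81) * x ^ 2 ≤ fejer T u * x ^ 2 := by nlinarith
  have := le_of_mul_le_mul_right h4 (by positivity)
  linarith

lemma fejer_add_ge {T : ℕ} (hT : T ≠ 0) {u : ℝ} (h0 : 0 ≤ u) (h1 : u ≤ 1) :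
    7 / 10 ≤ fejer T u + fejer T (u - 1) := by
  rcases le_or_gt u (1 / 4) with hu | hu
  · linarith [fejer_ge_of_abs_le_quarter hT (u := u) (by rw [abs_of_nonneg h0]; exact hu),
      fejer_nonneg T (u - 1)]
  rcases le_or_gt (3 / 4) u with hu' | hu'
  · linarith [fejer_ge_of_abs_le_quarter hT (u := u - 1) (by rw [abs_le]; constructor <;> linarith),
      fejer_nonneg T u]
  have hF := sin_sq_le_fejer hT u
  have hG := sin_sq_le_fejer hT (u - 1)
  have hs : Real.sin (Real.pi * (u - 1)) ^ 2 = Real.sin (Real.pi * u) ^ 2 := by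
    rw [mul_sub, mul_one, Real.sin_sub_pi, neg_sq]
  rw [hs] at hG
  -- The middle range is symmetric about 1/2. With cos y ≥ 1 − y²/2 and π² ≤ 3.15² = 9.9225, the
  -- claim becomes a polynomial inequality in v² ∈ [0, 1/16]. At v = 0 the kernel bounds add up to
  -- 8/π² ≈ 0.81, so 7/10 leaves room for these estimates.
  set v := u - 1 / 2 with hv
  have hu2 : u = v + 1 / 2 := by rw [hv]; ring
  have hcos : Real.sin (Real.pi * u) = Real.cos (Real.pi * v) := by
    rw [← Real.sin_add_pi_div_two]
    congr 1
    rw [hu2]; ring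
  have hc := Real.one_sub_sq_div_two_le_cos (x := Real.pi * v)
  rw [← hcos] at hc
  have hpi : Real.pi ^ 2 ≤ 9.9225 := by
    nlinarith [Real.pi_lt_d2, Real.pi_pos]
  have hv2 : v ^ 2 ≤ 1 / 16 := by nlinarith
  have hv0 : 0 ≤ v ^ 2 := sq_nonneg v
  have hc1 : 1 - 4.96125 * v ^ 2 ≤ Real.sin (Real.pi * u) := by
    refine le_trans ?_ hc
    rw [mul_pow]
    nlinarith
  have hc2 : (1 - 4.96125 * v ^ 2) ^ 2 ≤ Real.sin (Real.pi * u) ^ 2 :=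
    pow_le_pow_left₀ (by nlinarith) hc1 2
  set s := Real.sin (Real.pi * u) ^ 2 with hsdef
  have hs0 : 0 ≤ s := sq_nonneg _
  have hFpos := fejer_nonneg T u
  have hGpos := fejer_nonneg T (u - 1)
  have a1 : s ≤ fejer T u * (9.9225 * u ^ 2) := by
    refine hF.trans ?_
    rw [mul_pow]
    gcongr
  have a2 : s ≤ fejer T (u - 1) * (9.9225 * (1 - u) ^ 2) := by
    refine hG.trans ?_
    rw [mul_pow, show (u - 1) ^ 2 = (1 - u) ^ 2 by ring]
    gcongr
  have hu0 : 0 < u := by linarith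
  have hu1 : 0 < 1 - u := by linarith
  have b1 : s / (9.9225 * u ^ 2) ≤ fejer T u := (div_le_iff₀ (by positivity)).2 a1
  have b2 : s / (9.9225 * (1 - u) ^ 2) ≤ fejer T (u - 1) := (div_le_iff₀ (by positivity)).2 a2
  refine le_trans ?_ (add_le_add b1 b2)
  rw [div_add_div _ _ (by positivity) (by positivity), le_div_iff₀ (by positivity)]
  have e1 : u * (1 - u) = 1 / 4 - v ^ 2 := by rw [hu2]; ring
  have e2 : u ^ 2 + (1 - u) ^ 2 = 1 / 2 + 2 * v ^ 2 := by rw [hu2]; ring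
  have e3 : 7 / 10 * (9.9225 * u ^ 2 * (9.9225 * (1 - u) ^ 2))
      = 7 / 10 * 9.9225 ^ 2 * (1 / 4 - v ^ 2) ^ 2 := by rw [← e1]; ring
  have e4 : s * (9.9225 * (1 - u) ^ 2) + 9.9225 * u ^ 2 * s
      = 9.9225 * (1 / 2 + 2 * v ^ 2) * s := by rw [← e2]; ring
  rw [e3, e4]
  have key : 7 / 10 * 9.9225 * (1 / 4 - v ^ 2) ^ 2
      ≤ (1 / 2 + 2 * v ^ 2) * (1 - 4.96125 * v ^ 2) ^ 2 := by
    generalize v ^ 2 = q at *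
    nlinarith [mul_nonneg hv0 hv0, mul_nonneg hv0 (sub_nonneg.2 hv2),
      mul_nonneg (mul_nonneg hv0 hv0) hv0, mul_nonneg (mul_nonneg hv0 hv0) (sub_nonneg.2 hv2)]
  have := mul_le_mul_of_nonneg_left hc2 (by positivity : 0 ≤ 1 / 2 + 2 * v ^ 2)
  nlinarith

/-- The Fejér kernel centred at `w` puts weight at least `7/10` on the residues of integers at
distance at most `1` from `w`. -/
lemma sum_fejer_ge {T : ℕ} (hT : 2 ≤ T) (w : ℝ) (S : Finset (Fin T))
    (hS : ∀ (y : Fin T) (m k : ℤ), (y : ℤ) = m + k * T → |(m : ℝ) - w| ≤ 1 → y ∈ S) :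
    7 / 10 ≤ ∑ y ∈ S, fejer T (w - (y : ℕ)) := by
  have hT0 : T ≠ 0 := by omega
  have hTz : (0 : ℤ) < T := by omega
  have res : ∀ m : ℤ, ∃ y : Fin T, ∃ k : ℤ, (y : ℤ) = m + k * T := fun m =>
    ⟨⟨(m % T).toNat, by have := Int.emod_lt_of_pos m hTz; have := Int.emod_nonneg m hTz.ne'; omega⟩,
      -(m / T), by
        have := Int.emod_nonneg m hTz.ne'
        have h := Int.emod_add_mul_ediv m T
        simp only [Int.toNat_of_nonneg this]
        linarith⟩
  -- The two integers bracketing w have distinct residues because T ≥ 2, so both of their kernel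
  -- values count.
  obtain ⟨a, k, ha⟩ := res ⌊w⌋
  obtain ⟨b, l, hb⟩ := res (⌊w⌋ + 1)
  have hf0 := Int.floor_le w
  have hf1 := Int.lt_floor_add_one w
  have hab : a ≠ b := by
    rintro rfl
    have h : (k - l) * T = 1 := by linarith
    have := Int.le_of_dvd one_pos (Dvd.intro_left _ h)
    omega
  have haS : a ∈ S := hS a _ k ha (by rw [abs_le]; constructor <;> linarith)
  have hbS : b ∈ S := hS b _ l hb (by push_cast; rw [abs_le]; constructor <;> linarith)
  have ea : fejer T (w - (a : ℕ)) = fejer T (w - ⌊w⌋) := by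
    rw [← fejer_add_int_mul hT0 (w - ⌊w⌋) (-k)]
    congr 1
    have : ((a : ℕ) : ℝ) = ⌊w⌋ + k * T := by exact_mod_cast ha
    rw [this]; push_cast; ring
  have eb : fejer T (w - (b : ℕ)) = fejer T (w - ⌊w⌋ - 1) := by
    rw [← fejer_add_int_mul hT0 (w - ⌊w⌋ - 1) (-l)]
    congr 1
    have : ((b : ℕ) : ℝ) = ⌊w⌋ + 1 + l * T := by exact_mod_cast hb
    rw [this]; push_cast; ring
  calc (7 / 10 : ℝ) ≤ fejer T (w - ⌊w⌋) + fejer T (w - ⌊w⌋ - 1) :=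
        fejer_add_ge hT0 (by linarith) (by linarith)
    _ = ∑ y ∈ {a, b}, fejer T (w - (y : ℕ)) := by rw [Finset.sum_pair hab, ea, eb]
    _ ≤ _ := Finset.sum_le_sum_of_subset_of_nonneg
        (Finset.insert_subset haS (Finset.singleton_subset_iff.2 hbS))
        fun _ _ _ => fejer_nonneg _ _

/-! ### The median of independent runs -/

/-- Counting is invariant under permutation and monotone in sublists, so a block of the sorted list
can be compared with the unsorted entries. -/
lemma two_mul_card_ge_of_countP {N : ℕ} (v : Fin N → ℕ) (l m : List ℕ) (q : ℕ → Prop)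
    [DecidablePred q] (hl : l.Perm (List.ofFn v)) (hm : m.Sublist l) (hq : ∀ c ∈ m, q c)
    (hlen : N ≤ 2 * m.length) : N ≤ 2 * (Finset.univ.filter fun i => q (v i)).card := by
  have h1 : m.length = m.countP q := (List.countP_eq_length.2 fun c hc => by simpa using hq c hc).symm
  have h2 : m.countP q ≤ l.countP q := hm.countP_le
  have h3 : l.countP q = (Finset.univ.filter fun i => q (v i)).card := by
    rw [hl.countP_eq, List.ofFn_eq_map, List.countP_map, Finset.card_def, Finset.filter_val,
      ← Multiset.countP_eq_card_filter]
    rfl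
  omega

/-- If the median violates a two-sided bound, then at least half of the entries do. -/
lemma le_two_mul_card_of_median {N : ℕ} (hN : 0 < N) (v : Fin N → ℕ) (a b : ℝ)
    (h : ¬ (a ≤ median v ∧ median v ≤ b)) :
    N ≤ 2 * (Finset.univ.filter fun i => ¬ (a ≤ v i ∧ (v i : ℝ) ≤ b)).card := by
  classical
  set l := (List.ofFn v).mergeSort (fun a b => decide (a ≤ b)) with hl
  have hperm : l.Perm (List.ofFn v) := List.mergeSort_perm _ _
  have hsort : l.Pairwise (· ≤ ·) := by
    have := List.pairwise_mergeSort (le := fun a b : ℕ => decide (a ≤ b))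
      (by intro a b c; simpa using fun h1 h2 => le_trans h1 h2)
      (by intro a b; simpa using le_total a b) (List.ofFn v)
    simpa using this
  have hlen : l.length = N := by rw [hperm.length_eq, List.length_ofFn]
  have hk : (N - 1) / 2 < l.length := by omega
  have hmed : median v = l[(N - 1) / 2] := by
    unfold median
    rw [← hl]
    exact List.getD_eq_getElem _ _ hk
  rw [hmed] at h
  rw [List.pairwise_iff_getElem] at hsort
  -- If the median exceeds `b`, so does every entry from position (N − 1)/2 on; if it is below `a`,
  -- so is every entry up to and including that position. Either block has at least N/2 entries.
  by_cases ha : a ≤ (l[(N - 1) / 2] : ℕ)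
  · have hb : b < (l[(N - 1) / 2] : ℕ) := not_le.1 fun hb => h ⟨ha, hb⟩
    refine two_mul_card_ge_of_countP v l (l.drop ((N - 1) / 2)) (fun c => ¬ (a ≤ c ∧ (c : ℝ) ≤ b))
      hperm (List.drop_sublist _ _) ?_ (by rw [List.length_drop]; omega)
    intro c hc
    obtain ⟨i, hi, rfl⟩ := List.getElem_of_mem hc
    rw [List.getElem_drop]
    rw [List.length_drop] at hi
    have : l[(N - 1) / 2] ≤ l[(N - 1) / 2 + i] := by
      rcases Nat.eq_zero_or_pos i with h0 | h0
      · simp [h0]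
      · exact hsort _ _ _ _ (by omega)
    have : ((l[(N - 1) / 2] : ℕ) : ℝ) ≤ (l[(N - 1) / 2 + i] : ℕ) := by exact_mod_cast this
    rintro ⟨-, h2⟩
    linarith
  · refine two_mul_card_ge_of_countP v l (l.take ((N - 1) / 2 + 1))
      (fun c => ¬ (a ≤ c ∧ (c : ℝ) ≤ b))
      hperm (List.take_sublist _ _) ?_ (by rw [List.length_take]; omega)
    intro c hc
    obtain ⟨i, hi, rfl⟩ := List.getElem_of_mem hc
    rw [List.getElem_take]
    rw [List.length_take] at hi
    have : l[i] ≤ l[(N - 1) / 2] := by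
      rcases Nat.eq_or_lt_of_le (show i ≤ (N - 1) / 2 by omega) with h0 | h0
      · simp [h0]
      · exact hsort _ _ _ _ h0
    have : ((l[i] : ℕ) : ℝ) ≤ (l[(N - 1) / 2] : ℕ) := by exact_mod_cast this
    rintro ⟨h1, -⟩
    linarith

open MeasureTheory in
/-- Chernoff bound for the majority of independent trials with success probability at least
`7/10`. -/
lemma measureReal_majority_fail_le {Ω : Type*} [Fintype Ω] [MeasurableSpace Ω]
    [MeasurableSingletonClass Ω] (μ : Measure Ω) [IsProbabilityMeasure μ] (N : ℕ) (S : Finset Ω)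
    (hS : 7 / 10 ≤ μ.real S) :
    (Measure.pi fun _ : Fin N => μ).real
      {ω | ∃ J : Finset (Fin N), N ≤ 2 * J.card ∧ ∀ i ∈ J, ω i ∉ S} ≤ (11 / 12) ^ N := by
  classical
  -- Exponential Markov: the product of these weights is at least 1 whenever at least half of the
  -- trials fail, and the mean of one weight is at most 0.7 · 2/3 + 0.3 · 3/2 = 11/12.
  set h : Ω → ℝ := fun y => if y ∈ S then 2 / 3 else 3 / 2 with hh
  have hmean : ∫ y, h y ∂μ ≤ 11 / 12 := by
    have e : h = fun y => 3 / 2 - (5 / 6) * (S : Set Ω).indicator (fun _ => (1 : ℝ)) y := by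
      funext y
      by_cases hy : y ∈ S <;> simp [hh, hy]; norm_num
    rw [e, integral_sub (integrable_const _) (Integrable.of_finite), integral_const_mul,
      integral_indicator_const _ S.measurableSet]
    simp
    linarith
  have hpos : ∀ y, 0 < h y := fun y => by simp only [hh]; split_ifs <;> norm_num
  have hmean0 : 0 ≤ ∫ y, h y ∂μ := integral_nonneg fun y => (hpos y).le
  have hprod : ∫ ω, ∏ i, h (ω i) ∂(Measure.pi fun _ : Fin N => μ) ≤ (11 / 12) ^ N := by
    rw [integral_fintype_prod_eq_prod (μ := fun _ : Fin N => μ) (f := fun _ => h)]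
    simp only [Finset.prod_const, Finset.card_univ, Fintype.card_fin]
    exact pow_le_pow_left₀ hmean0 hmean N
  refine le_trans ?_ hprod
  have hmk := mul_meas_ge_le_integral_of_nonneg (μ := Measure.pi fun _ : Fin N => μ)
    (f := fun ω => ∏ i, h (ω i))
    (Filter.Eventually.of_forall fun ω => Finset.prod_nonneg fun i _ => (hpos _).le)
    Integrable.of_finite 1
  rw [one_mul] at hmk
  refine le_trans (measureReal_mono ?_) hmk
  rintro ω ⟨J, hJ, hJS⟩
  show (1 : ℝ) ≤ ∏ i, h (ω i)
  have h1 : ∏ i ∈ J, h (ω i) = (3 / 2) ^ J.card := by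
    rw [← Finset.prod_const]
    exact Finset.prod_congr rfl fun i hi => if_neg (hJS i hi)
  have h2 : (2 / 3 : ℝ) ^ (Jᶜ).card ≤ ∏ i ∈ Jᶜ, h (ω i) := by
    rw [← Finset.prod_const]
    refine Finset.prod_le_prod (fun _ _ => by norm_num) fun i _ => ?_
    simp only [hh]; split_ifs <;> norm_num
  have hc : (Jᶜ).card ≤ J.card := by
    rw [Finset.card_compl, Fintype.card_fin]; omega
  rw [← Finset.prod_mul_prod_compl J, h1]
  calc (1 : ℝ) = (3 / 2) ^ J.card * (2 / 3) ^ J.card := by rw [← mul_pow]; norm_num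
    _ ≤ (3 / 2) ^ J.card * (2 / 3) ^ (Jᶜ).card := by
        gcongr ?_ * ?_
        exact pow_le_pow_of_le_one (by norm_num) (by norm_num) hc
    _ ≤ _ := by gcongr

lemma reps_pos {δ : ℝ} (hδ : δ ∈ Set.Ioo (0 : ℝ) 1) : 0 < reps δ := by
  have : 0 < Real.log (1 / δ) := Real.log_pos (by rw [lt_div_iff₀ hδ.1]; linarith [hδ.2])
  exact Nat.ceil_pos.2 (by positivity)

/-- Since 11/12 ≤ e^{−1/12}, already 12 ln(1/δ) repetitions would do. -/
lemma pow_reps_le {δ : ℝ} (hδ : δ ∈ Set.Ioo (0 : ℝ) 1) : (11 / 12 : ℝ) ^ reps δ ≤ δ := by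
  have hL : 0 < Real.log (1 / δ) := Real.log_pos (by rw [lt_div_iff₀ hδ.1]; linarith [hδ.2])
  have hN : 17 * Real.log (1 / δ) ≤ reps δ := Nat.le_ceil _
  have h1 : (11 / 12 : ℝ) ≤ Real.exp (-(1 / 12)) := by
    linarith [Real.add_one_le_exp (-(1 / 12 : ℝ))]
  calc (11 / 12 : ℝ) ^ reps δ ≤ Real.exp (-(1 / 12)) ^ reps δ := by gcongr
    _ = Real.exp (-(reps δ / 12)) := by rw [← Real.exp_nat_mul]; congr 1; ring
    _ ≤ Real.exp (Real.log δ) := by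
        rw [Real.exp_le_exp]
        rw [one_div, Real.log_inv] at hL hN
        linarith
    _ = δ := Real.exp_log hδ.1

/-! ### The phase estimation circuit -/

lemma circuitUnitary_append {t n : ℕ} (f : Bits n → Fin 2) (C D : List (Gate t n)) :
    circuitUnitary f (C ++ D) = circuitUnitary f D * circuitUnitary f C := by
  induction C with
  | nil => simp [circuitUnitary]
  | cons G C ih => simp [circuitUnitary, ih, mul_assoc]

lemma controlled_mulVec {t n : ℕ} (k : Fin t) (V : Matrix.unitaryGroup (Bits n) ℂ)
    (s : Reg t n → ℂ) (y : Bits t) (b : Bits n) :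
    ((controlled k V).1 *ᵥ s) (y, b)
      = ((if y k = 1 then V.1 else 1) *ᵥ fun c => s (y, c)) b := by
  rw [Matrix.mulVec, dotProduct, Fintype.sum_prod_type, Finset.sum_eq_single y]
  · by_cases hk : y k = 1 <;> simp [controlled, hk, Matrix.mulVec, dotProduct]
  · intro w _ hw
    simp [controlled, Ne.symm hw]
  · simp

/-- Grover's operator `G = (U R₀ U†) O_f`. -/
noncomputable def grover {n : ℕ} (pPlus pMinus : ℝ) (f : Bits n → Fin 2) (x : Bits n) :
    Matrix (Bits n) (Bits n) ℂ :=
  (reflPsi pPlus pMinus x).1 * (oracle f).1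

/-- A controlled query followed by a controlled reflection is a controlled Grover step. Working on
the slice of fixed `y`, the exponent `y k * m` covers both values of the control bit. -/
lemma controlled_grover_pow_mulVec {t n : ℕ} (pPlus pMinus : ℝ) (f : Bits n → Fin 2) (x : Bits n)
    (k : Fin t) (m : ℕ) (s : Reg t n → ℂ) (y : Bits t) (b : Bits n) :
    ((circuitUnitary f (List.replicate m
        [Gate.query k, Gate.free (controlled k (reflPsi pPlus pMinus x))]).flatten).1 *ᵥ s) (y, b)
      = (grover pPlus pMinus f x ^ ((y k : ℕ) * m) *ᵥ fun c => s (y, c)) b := by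
  induction m generalizing s b with
  | zero => simp [circuitUnitary]
  | succ m ih =>
    have hstep : ∀ c, ((circuitUnitary f
        [Gate.query k, Gate.free (controlled k (reflPsi pPlus pMinus x))]).1 *ᵥ s) (y, c)
        = (grover pPlus pMinus f x ^ (y k : ℕ) *ᵥ fun c => s (y, c)) c := by
      intro c
      have : (circuitUnitary f
          [Gate.query k, Gate.free (controlled k (reflPsi pPlus pMinus x))]).1
          = (controlled k (reflPsi pPlus pMinus x)).1 * (controlled k (oracle f)).1 := by
        simp [circuitUnitary, Gate.unitary]
      rw [this, ← Matrix.mulVec_mulVec, controlled_mulVec]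
      simp only [controlled_mulVec]
      generalize y k = z
      fin_cases z
      · simp
      · simp [grover, Matrix.mulVec_mulVec]
    rw [List.replicate_succ, List.flatten_cons, circuitUnitary_append, Submonoid.coe_mul,
      ← Matrix.mulVec_mulVec, ih]
    simp only [hstep]
    rw [Matrix.mulVec_mulVec, ← pow_add, Nat.mul_succ]

/-- An arbitrary list makes the induction possible; for all counting qubits the exponent is ∑ y_k
2^k = `value y`. -/
lemma controlled_grover_list_mulVec {t n : ℕ} (pPlus pMinus : ℝ) (f : Bits n → Fin 2)
    (x : Bits n) (l : List (Fin t)) (s : Reg t n → ℂ) (y : Bits t) (b : Bits n) :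
    ((circuitUnitary f (l.flatMap fun k : Fin t => (List.replicate (2 ^ (k : ℕ))
        [Gate.query k, Gate.free (controlled k (reflPsi pPlus pMinus x))]).flatten)).1 *ᵥ s) (y, b)
      = (grover pPlus pMinus f x ^ (l.map fun k : Fin t => (y k : ℕ) * 2 ^ (k : ℕ)).sum *ᵥ
          fun c => s (y, c)) b := by
  induction l generalizing s b with
  | nil => simp [circuitUnitary]
  | cons k l ih =>
    rw [List.flatMap_cons, circuitUnitary_append, Submonoid.coe_mul, ← Matrix.mulVec_mulVec, ih]
    simp only [controlled_grover_pow_mulVec]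
    rw [Matrix.mulVec_mulVec, ← pow_add, List.map_cons, List.sum_cons, add_comm]

/-- The state `U |0⟩` that the distribution loader prepares. -/
noncomputable def loaded {n : ℕ} (pPlus pMinus : ℝ) (x : Bits n) (b : Bits n) : ℂ :=
  (loader pPlus pMinus x).1 b 0

lemma tensor_hadamard_apply_zero {t : ℕ} (y : Bits t) :
    tensor (fun _ => hadamard) y 0 = ((Real.sqrt (2 ^ t))⁻¹ : ℂ) := by
  have h : ∀ z : Fin 2, hadamard z 0 = ((Real.sqrt 2)⁻¹ : ℂ) := by
    intro z; fin_cases z <;> simp [hadamard]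
  simp only [tensor, Matrix.of_apply, Pi.zero_apply, h, Finset.prod_const, Finset.card_univ,
    Fintype.card_fin]
  rw [inv_pow]
  congr 1
  norm_cast
  rw [← Real.sqrt_sq (x := Real.sqrt 2 ^ t) (by positivity), ← pow_mul, mul_comm, pow_mul,
    Real.sq_sqrt (by norm_num)]
  norm_cast

lemma mulVec_single_zero {ι : Type*} [Fintype ι] [DecidableEq ι] (A : Matrix ι ι ℂ) (i j : ι) :
    (A *ᵥ Pi.single j 1) i = A i j := by
  simp

/-- The amplitudes are the discrete Fourier transform of the orbit m ↦ G^m ψ; the Hadamards and the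
inverse transform each contribute a factor T^{−1/2}. -/
lemma phaseCircuit_apply {t n : ℕ} (pPlus pMinus : ℝ) (f : Bits n → Fin 2) (x : Bits n)
    (z : Bits t) (b : Bits n) :
    (circuitUnitary f (phaseCircuit t pPlus pMinus x)).1 (z, b) (0, 0)
      = ((2 ^ t : ℕ) : ℂ)⁻¹ * ∑ m ∈ Finset.range (2 ^ t),
          Complex.exp (-(2 * Real.pi * Complex.I * m * value z / 2 ^ t)) *
            (grover pPlus pMinus f x ^ m *ᵥ loaded pPlus pMinus x) b := by
  have hs : ((Real.sqrt (2 ^ t))⁻¹ : ℂ) * ((Real.sqrt (2 ^ t))⁻¹ : ℂ) = (2 ^ t : ℂ)⁻¹ := by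
    rw [← mul_inv, ← Complex.ofReal_mul, Real.mul_self_sqrt (by positivity)]
    push_cast
    rfl
  have hstart : ∀ y c, ((circuitUnitary f
      [(Gate.free (both ⟨tensor fun _ => hadamard, tensor_mem fun _ => hadamard_mem⟩
        (loader pPlus pMinus x)) : Gate t n)]).1 *ᵥ Pi.single (0, 0) 1) (y, c)
      = ((Real.sqrt (2 ^ t))⁻¹ : ℂ) * loaded pPlus pMinus x c := by
    intro y c
    rw [mulVec_single_zero]
    simp [circuitUnitary, Gate.unitary, both, tensor_hadamard_apply_zero, loaded]
  have hval : ∀ y : Bits t,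
      ((List.finRange t).map fun k : Fin t => (y k : ℕ) * 2 ^ (k : ℕ)).sum = value y := by
    intro y
    rw [value, finFunctionFinEquiv_apply, Fin.sum_univ_def]
  rw [← mulVec_single_zero (circuitUnitary f (phaseCircuit t pPlus pMinus x)).1, phaseCircuit,
    circuitUnitary_append, circuitUnitary_append,
    Submonoid.coe_mul, Submonoid.coe_mul, ← Matrix.mulVec_mulVec, ← Matrix.mulVec_mulVec]
  rw [Matrix.mulVec, dotProduct, Fintype.sum_prod_type]
  have hterm : ∀ y : Bits t, ∑ c : Bits n, (circuitUnitary f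
      [(Gate.free (both ⟨iqft t, iqft_mem t⟩ 1) : Gate t n)]).1 (z, b) (y, c) *
        ((circuitUnitary f ((List.finRange t).flatMap fun k : Fin t =>
          (List.replicate (2 ^ (k : ℕ))
          [Gate.query k, Gate.free (controlled k (reflPsi pPlus pMinus x))]).flatten)).1 *ᵥ
          ((circuitUnitary f
      [(Gate.free (both ⟨tensor fun _ => hadamard, tensor_mem fun _ => hadamard_mem⟩
        (loader pPlus pMinus x)) : Gate t n)]).1 *ᵥ Pi.single (0, 0) 1)) (y, c)
      = ((2 ^ t : ℕ) : ℂ)⁻¹ * (Complex.exp (-(2 * Real.pi * Complex.I * value y * value z / 2 ^ t)) *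
            (grover pPlus pMinus f x ^ value y *ᵥ loaded pPlus pMinus x) b) := by
    intro y
    simp only [controlled_grover_list_mulVec, hstart, hval]
    have hsm : ∀ (A : Matrix (Bits n) (Bits n) ℂ) (c : Bits n),
        (A *ᵥ fun c => ((Real.sqrt (2 ^ t))⁻¹ : ℂ) * loaded pPlus pMinus x c) c
        = ((Real.sqrt (2 ^ t))⁻¹ : ℂ) * (A *ᵥ loaded pPlus pMinus x) c := by
      intro A c
      exact congrFun (Matrix.mulVec_smul A ((Real.sqrt (2 ^ t))⁻¹ : ℂ) (loaded pPlus pMinus x)) c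
    simp only [hsm]
    rw [Finset.sum_eq_single b]
    · simp only [circuitUnitary, Gate.unitary, both, one_mul, Matrix.kroneckerMap_apply,
        OneMemClass.coe_one, Matrix.one_apply_eq, mul_one, iqft, Matrix.of_apply]
      push_cast
      rw [← hs]
      ring
    · intro c _ hc
      simp [circuitUnitary, Gate.unitary, both, Matrix.one_apply_ne hc.symm]
    · simp
  rw [Finset.sum_congr rfl fun y _ => hterm y, ← Finset.mul_sum]
  congr 1
  rw [← Fin.sum_univ_eq_sum_range (fun m : ℕ =>
    Complex.exp (-(2 * Real.pi * Complex.I * m * value z / 2 ^ t)) *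
            (grover pPlus pMinus f x ^ m *ᵥ loaded pPlus pMinus x) b),
    ← Equiv.sum_comp finFunctionFinEquiv]
  rfl

/-! ### The action of Grover's operator -/

/-- With A = arccos √(1 − p₊) and B = arccos √(1 − p₋), a bit 0 gives RY(2A)|0⟩, which flips with
probability sin²A = p₊. For a bit 1, RX(π) produces |1⟩ up to a phase and the angle collapses to
−2B, so the flip probability is sin²B = p₋. -/
lemma norm_loaded_sq {n : ℕ} {pPlus pMinus : ℝ} (hp : pPlus ∈ Set.Icc (0 : ℝ) 1)
    (hm : pMinus ∈ Set.Icc (0 : ℝ) 1) (x b : Bits n) :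
    ‖loaded pPlus pMinus x b‖ ^ 2 = transProb pPlus pMinus x b := by
  have hcos : ∀ p ∈ Set.Icc (0 : ℝ) 1, Real.cos (Real.arccos (Real.sqrt (1 - p))) ^ 2 = 1 - p := by
    intro p hp
    rw [Real.cos_arccos (by linarith [Real.sqrt_nonneg (1 - p)])
      (Real.sqrt_le_one.2 (by linarith [hp.1])), Real.sq_sqrt (by linarith [hp.2])]
  have hsin : ∀ p ∈ Set.Icc (0 : ℝ) 1, Real.sin (Real.arccos (Real.sqrt (1 - p))) ^ 2 = p := by
    intro p hp
    rw [Real.sin_sq, hcos p hp]; ring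
  unfold loaded transProb
  simp only [loader, tensor, Matrix.of_apply, Pi.zero_apply, norm_prod, ← Finset.prod_pow]
  refine Finset.prod_congr rfl fun j _ => ?_
  set A := Real.arccos (Real.sqrt (1 - pPlus)) with hA
  set B := Real.arccos (Real.sqrt (1 - pMinus)) with hB
  have h2 : (2 * A + -(2 * (A + B))) / 2 = -B := by ring
  have cA : Real.cos A ^ 2 = 1 - pPlus := hcos _ hp
  have sA : Real.sin A ^ 2 = pPlus := hsin _ hp
  have cB : Real.cos B ^ 2 = 1 - pMinus := hcos _ hm
  have sB : Real.sin B ^ 2 = pMinus := hsin _ hm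
  have hA2 : 2 * A / 2 = A := by ring
  generalize x j = xj
  generalize b j = bj
  fin_cases xj <;> fin_cases bj <;>
    simp [ry, rx, flipProb, Matrix.mul_apply, Fin.sum_univ_two, -Complex.ofReal_cos,
      -Complex.ofReal_sin, hA2, h2, cA, sA, cB, sB]

lemma reflPsi_mulVec {n : ℕ} (pPlus pMinus : ℝ) (x : Bits n) (v : Bits n → ℂ) (b : Bits n) :
    ((reflPsi pPlus pMinus x).1 *ᵥ v) b
      = 2 * loaded pPlus pMinus x b * ∑ c, star (loaded pPlus pMinus x c) * v c - v b := by
  have hR : (reflZero n).1 = (2 : ℂ) • Matrix.single (0 : Bits n) (0 : Bits n) (1 : ℂ) - 1 := by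
    ext a c
    by_cases hac : a = c
    · subst hac
      by_cases ha : a = 0
      · subst ha; simp [reflZero]; norm_num
      · simp [reflZero, ha, Ne.symm ha]
    · have : ¬ (0 = a ∧ 0 = c) := fun h => hac (h.1.symm.trans h.2)
      simp [reflZero, hac, this]
  have hU : (loader pPlus pMinus x).1 * star (loader pPlus pMinus x).1 = 1 :=
    Matrix.mem_unitaryGroup_iff.1 (loader pPlus pMinus x).2
  have e : (reflPsi pPlus pMinus x).1 = (2 : ℂ) • ((loader pPlus pMinus x).1 *
      Matrix.single (0 : Bits n) (0 : Bits n) (1 : ℂ) * star (loader pPlus pMinus x).1) - 1 := by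
    show (loader pPlus pMinus x).1 * (reflZero n).1 * star (loader pPlus pMinus x).1 = _
    rw [hR, mul_sub, sub_mul, mul_one, hU, Matrix.mul_smul, Matrix.smul_mul]
  have e2 : ∀ c, ((loader pPlus pMinus x).1 * Matrix.single (0 : Bits n) (0 : Bits n) (1 : ℂ) *
      star (loader pPlus pMinus x).1) b c
      = loaded pPlus pMinus x b * star (loaded pPlus pMinus x c) := by
    intro c
    rw [Matrix.mul_apply, Finset.sum_eq_single 0]
    · simp [loaded, Matrix.star_apply]
    · intro d _ hd
      simp [Matrix.mul_single_apply_of_ne, hd]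
    · simp
  rw [e, Matrix.sub_mulVec, Matrix.smul_mulVec, Matrix.one_mulVec]
  simp only [Pi.sub_apply, Pi.smul_apply, Matrix.mulVec, dotProduct, e2, smul_eq_mul]
  rw [mul_assoc 2, Finset.mul_sum (a := loaded pPlus pMinus x b)]
  simp only [mul_assoc]

lemma sum_norm_loaded_sq {n : ℕ} (pPlus pMinus : ℝ) (x : Bits n) :
    ∑ b, ‖loaded pPlus pMinus x b‖ ^ 2 = 1 := by
  have h := congrFun (congrFun
    (Matrix.mem_unitaryGroup_iff'.1 (loader pPlus pMinus x).2) 0) 0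
  rw [Matrix.mul_apply, Matrix.one_apply_eq] at h
  simp only [Matrix.star_apply, RCLike.star_def, Complex.conj_mul'] at h
  exact_mod_cast h

/-- Quantities that depend on `b` only through `f b` are averaged with the weights g(x) and 1 −
g(x); this is how g(x) enters the analysis. -/
lemma sum_norm_loaded_sq_mul_ite {n : ℕ} {pPlus pMinus : ℝ} (hp : pPlus ∈ Set.Icc (0 : ℝ) 1)
    (hm : pMinus ∈ Set.Icc (0 : ℝ) 1) (f : Bits n → Fin 2) (x : Bits n) (A B : ℝ) :
    ∑ b, ‖loaded pPlus pMinus x b‖ ^ 2 * (if f b = 1 then A else B)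
      = smooth pPlus pMinus f x * A + (1 - smooth pPlus pMinus f x) * B := by
  have hg : smooth pPlus pMinus f x
      = ∑ b, ‖loaded pPlus pMinus x b‖ ^ 2 * (if f b = 1 then 1 else 0) := by
    rw [smooth, Finset.sum_filter]
    simp [norm_loaded_sq hp hm]
  have h1 := sum_norm_loaded_sq pPlus pMinus x
  have : (1 - smooth pPlus pMinus f x)
      = ∑ b, ‖loaded pPlus pMinus x b‖ ^ 2 * (if f b = 1 then 0 else 1) := by
    rw [hg, sub_eq_iff_eq_add, ← Finset.sum_add_distrib]
    refine h1.symm.trans (Finset.sum_congr rfl fun b _ => ?_)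
    split_ifs <;> simp
  rw [this, hg, Finset.sum_mul, Finset.sum_mul, ← Finset.sum_add_distrib]
  refine Finset.sum_congr rfl fun b _ => ?_
  split_ifs <;> simp

/-- `s` and `c` are the amplitudes on the two parts relative to ψ. The product form of their
equations covers sin θ = 0 and cos θ = 0, where dividing would fail. -/
lemma grover_pow_mulVec_loaded {n : ℕ} {pPlus pMinus : ℝ} (hp : pPlus ∈ Set.Icc (0 : ℝ) 1)
    (hm : pMinus ∈ Set.Icc (0 : ℝ) 1) (f : Bits n → Fin 2) (x : Bits n) {θ : ℝ}
    (hθ : smooth pPlus pMinus f x = Real.sin θ ^ 2) (m : ℕ) :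
    ∃ s c : ℝ, Real.sin θ * s = Real.sin ((2 * m + 1) * θ) ∧
      Real.cos θ * c = Real.cos ((2 * m + 1) * θ) ∧
      ∀ b, (grover pPlus pMinus f x ^ m *ᵥ loaded pPlus pMinus x) b
        = loaded pPlus pMinus x b * ((if f b = 1 then s else c : ℝ) : ℂ) := by
  induction m with
  | zero => exact ⟨1, 1, by simp, by simp, by simp⟩
  | succ m ih =>
    obtain ⟨s, c, hs, hc, h⟩ := ih
    have hcos : 1 - smooth pPlus pMinus f x = Real.cos θ ^ 2 := by
      rw [hθ, Real.cos_sq']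
    have e1 : (2 * ((m + 1 : ℕ) : ℝ) + 1) * θ = (2 * m + 1) * θ + 2 * θ := by push_cast; ring
    have hsq := Real.sin_sq_add_cos_sq θ
    -- The oracle turns (s, c) into (−s, c), whose overlap with ψ is cos²θ · c − sin²θ · s; then v ↦
    -- 2⟨ψ, v⟩ψ − v is applied.
    refine ⟨2 * (Real.cos θ ^ 2 * c - Real.sin θ ^ 2 * s) + s,
      2 * (Real.cos θ ^ 2 * c - Real.sin θ ^ 2 * s) - c, ?_, ?_, ?_⟩
    · rw [e1, Real.sin_add, ← hs, ← hc, Real.sin_two_mul, Real.cos_two_mul]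
      linear_combination (-2 * Real.sin θ * s) * hsq
    · rw [e1, Real.cos_add, ← hs, ← hc, Real.sin_two_mul, Real.cos_two_mul]
      ring
    · intro b
      have hO : ∀ d, ((oracle f).1 *ᵥ (grover pPlus pMinus f x ^ m *ᵥ loaded pPlus pMinus x)) d
          = loaded pPlus pMinus x d * ((if f d = 1 then -s else c : ℝ) : ℂ) := by
        intro d
        simp only [oracle, Matrix.mulVec_diagonal, h]
        generalize f d = z
        fin_cases z <;> simp
      rw [pow_succ', ← Matrix.mulVec_mulVec, grover, ← Matrix.mulVec_mulVec, ← grover,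
        reflPsi_mulVec]
      simp only [hO]
      have hin : ∑ d, star (loaded pPlus pMinus x d) *
          (loaded pPlus pMinus x d * ((if f d = 1 then -s else c : ℝ) : ℂ))
          = ((Real.cos θ ^ 2 * c - Real.sin θ ^ 2 * s : ℝ) : ℂ) := by
        have := sum_norm_loaded_sq_mul_ite hp hm f x (-s) c
        rw [hcos, hθ] at this
        rw [show Real.cos θ ^ 2 * c - Real.sin θ ^ 2 * s
          = Real.sin θ ^ 2 * -s + Real.cos θ ^ 2 * c by ring, ← this, Complex.ofReal_sum]
        refine Finset.sum_congr rfl fun d _ => ?_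
        rw [← mul_assoc, RCLike.star_def, Complex.conj_mul']
        push_cast
        rfl
      rw [hin]
      split_ifs <;> push_cast <;> ring

/-- Passes from the two parts of the state to the eigenvectors of the rotation: sine and cosine
amplitudes combine into e^{±i(2m+1)θ}. -/
lemma normSq_add_normSq (A B : ℂ) :
    ‖A‖ ^ 2 + ‖B‖ ^ 2 = (‖B + Complex.I * A‖ ^ 2 + ‖B - Complex.I * A‖ ^ 2) / 2 := by
  have := parallelogram_law_with_norm ℝ B (Complex.I * A)
  rw [norm_mul, Complex.norm_I, one_mul] at this
  linarith

/-- The common phase e^{iφ} has modulus 1, and the remaining phases are linear in m. -/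
lemma norm_sum_exp_sq (T : ℕ) (hT : T ≠ 0) (φ z : ℝ) :
    ‖(T : ℂ)⁻¹ * ∑ m ∈ Finset.range T, Complex.exp (-(2 * Real.pi * Complex.I * m * z / T)) *
      Complex.exp (((2 * m + 1) * φ : ℝ) * Complex.I)‖ ^ 2 = fejer T (T * φ / Real.pi - z) := by
  have hTc : (T : ℂ) ≠ 0 := by exact_mod_cast hT
  have hpi : (Real.pi : ℂ) ≠ 0 := by exact_mod_cast Real.pi_ne_zero
  have e : ∑ m ∈ Finset.range T, Complex.exp (-(2 * Real.pi * Complex.I * m * z / T)) *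
      Complex.exp (((2 * m + 1) * φ : ℝ) * Complex.I)
      = Complex.exp (φ * Complex.I) * ∑ m ∈ Finset.range T,
        Complex.exp (2 * Real.pi * Complex.I * m * ((T * φ / Real.pi - z : ℝ) : ℂ) / T) := by
    rw [Finset.mul_sum]
    refine Finset.sum_congr rfl fun m _ => ?_
    rw [← Complex.exp_add, ← Complex.exp_add]
    congr 1
    push_cast
    field_simp
    ring
  rw [fejer, e, norm_mul, norm_mul, norm_mul, Complex.norm_exp_ofReal_mul_I, one_mul]

lemma measure_phaseCircuit_apply {t n : ℕ} {pPlus pMinus : ℝ} (hp : pPlus ∈ Set.Icc (0 : ℝ) 1)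
    (hm : pMinus ∈ Set.Icc (0 : ℝ) 1) (f : Bits n → Fin 2) (x : Bits n) {θ : ℝ}
    (hθ : smooth pPlus pMinus f x = Real.sin θ ^ 2) (z : Bits t) :
    measure f (phaseCircuit t pPlus pMinus x) z = ENNReal.ofReal
      ((fejer (2 ^ t) ((2 ^ t : ℕ) * θ / Real.pi - value z) +
        fejer (2 ^ t) (-((2 ^ t : ℕ) * θ / Real.pi) - value z)) / 2) := by
  choose s c hs hc h using grover_pow_mulVec_loaded hp hm f x hθ
  rw [measure, PMF.ofFintype_apply]
  congr 1
  set T := 2 ^ t with hT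
  have hT0 : T ≠ 0 := by positivity
  set E : ℕ → ℂ := fun m => Complex.exp (-(2 * Real.pi * Complex.I * m * (value z : ℝ) / T)) with hE
  set A : ℂ := (T : ℂ)⁻¹ * ∑ m ∈ Finset.range T, E m * (s m : ℂ) with hA
  set B : ℂ := (T : ℂ)⁻¹ * ∑ m ∈ Finset.range T, E m * (c m : ℂ) with hB
  have hamp : ∀ b, ‖(circuitUnitary f (phaseCircuit t pPlus pMinus x)).1 (z, b) (0, 0)‖ ^ 2
      = ‖loaded pPlus pMinus x b‖ ^ 2 * (if f b = 1 then ‖A‖ ^ 2 else ‖B‖ ^ 2) := by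
    intro b
    have : (circuitUnitary f (phaseCircuit t pPlus pMinus x)).1 (z, b) (0, 0)
        = loaded pPlus pMinus x b * (if f b = 1 then A else B) := by
      rw [phaseCircuit_apply]
      simp only [h]
      have h2 : ((2 : ℂ) ^ t) = (T : ℂ) := by rw [hT]; push_cast; rfl
      split_ifs
      · rw [hA, mul_left_comm, Finset.mul_sum (a := loaded pPlus pMinus x b)]
        congr 1
        refine Finset.sum_congr rfl fun m _ => ?_
        simp only [hE, h2, Complex.ofReal_natCast]
        ring
      · rw [hB, mul_left_comm, Finset.mul_sum (a := loaded pPlus pMinus x b)]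
        congr 1
        refine Finset.sum_congr rfl fun m _ => ?_
        simp only [hE, h2, Complex.ofReal_natCast]
        ring
    rw [this, norm_mul, mul_pow]
    split_ifs <;> rfl
  rw [Finset.sum_congr rfl fun b _ => hamp b, sum_norm_loaded_sq_mul_ite hp hm, hθ,
    ← Real.cos_sq']
  have n1 : ∀ (r : ℝ) (w : ℂ), r ^ 2 * ‖w‖ ^ 2 = ‖(r : ℂ) * w‖ ^ 2 := fun r w => by
    rw [norm_mul, mul_pow, Complex.norm_real, Real.norm_eq_abs, sq_abs]
  rw [n1, n1, normSq_add_normSq]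
  have eA : (Real.sin θ : ℂ) * A
      = (T : ℂ)⁻¹ * ∑ m ∈ Finset.range T, E m * (Real.sin ((2 * m + 1) * θ) : ℂ) := by
    rw [hA, mul_left_comm, Finset.mul_sum (a := (Real.sin θ : ℂ))]
    congr 1
    refine Finset.sum_congr rfl fun m _ => ?_
    rw [← hs]; push_cast; ring
  have eB : (Real.cos θ : ℂ) * B
      = (T : ℂ)⁻¹ * ∑ m ∈ Finset.range T, E m * (Real.cos ((2 * m + 1) * θ) : ℂ) := by
    rw [hB, mul_left_comm, Finset.mul_sum (a := (Real.cos θ : ℂ))]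
    congr 1
    refine Finset.sum_congr rfl fun m _ => ?_
    rw [← hc]; push_cast; ring
  have p1 : (Real.cos θ : ℂ) * B + Complex.I * ((Real.sin θ : ℂ) * A)
      = (T : ℂ)⁻¹ * ∑ m ∈ Finset.range T,
        E m * Complex.exp (((2 * m + 1) * θ : ℝ) * Complex.I) := by
    rw [eA, eB, mul_left_comm, ← mul_add, Finset.mul_sum (a := Complex.I),
      ← Finset.sum_add_distrib]
    congr 1
    refine Finset.sum_congr rfl fun m _ => ?_
    rw [Complex.exp_mul_I, ← Complex.ofReal_cos, ← Complex.ofReal_sin]; ring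
  have p2 : (Real.cos θ : ℂ) * B - Complex.I * ((Real.sin θ : ℂ) * A)
      = (T : ℂ)⁻¹ * ∑ m ∈ Finset.range T,
        E m * Complex.exp (((2 * m + 1) * (-θ) : ℝ) * Complex.I) := by
    rw [eA, eB, mul_left_comm, ← mul_sub, Finset.mul_sum (a := Complex.I),
      ← Finset.sum_sub_distrib]
    congr 1
    refine Finset.sum_congr rfl fun m _ => ?_
    rw [Complex.exp_mul_I, ← Complex.ofReal_cos, ← Complex.ofReal_sin, mul_neg, Real.cos_neg,
      Real.sin_neg]
    push_cast
    ring
  rw [p1, p2]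
  simp only [hE]
  rw [norm_sum_exp_sq T hT0, norm_sum_exp_sq T hT0, mul_neg, neg_div]

/-! ### The outputs of phase estimation -/

lemma value_lt {t : ℕ} (y : Bits t) : value y < 2 ^ t := (finFunctionFinEquiv y).2

lemma cast_gridIndex {t : ℕ} (y : Bits t) :
    (gridIndex y : ℝ) = min (value y : ℝ) (2 ^ t - value y) := by
  rw [gridIndex, Nat.cast_min, Nat.cast_sub (value_lt y).le]
  push_cast
  rfl

/-- The index of y is its distance to Tℤ. This distance is 1-Lipschitz, even and T-periodic, and
equals w at both w and −w because 0 ≤ w ≤ T/2. -/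
lemma gridIndex_near {t : ℕ} (y : Bits t) {w : ℝ} (hw0 : 0 ≤ w) (hw : 2 * w ≤ 2 ^ t) {m k : ℤ}
    (hy : (value y : ℤ) = m + k * (2 ^ t : ℕ)) (hm : |(m : ℝ) - w| ≤ 1 ∨ |(m : ℝ) - -w| ≤ 1) :
    w - 1 ≤ gridIndex y ∧ (gridIndex y : ℝ) ≤ w + 1 := by
  have hlt : (value y : ℝ) < 2 ^ t := by exact_mod_cast value_lt y
  have h0 : (0 : ℝ) ≤ value y := Nat.cast_nonneg _
  have hy' : (value y : ℝ) = m + k * 2 ^ t := by exact_mod_cast hy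
  rw [cast_gridIndex, le_min_iff, min_le_iff]
  generalize (value y : ℝ) = v at *
  have hT : (0 : ℝ) < 2 ^ t := by positivity
  generalize (2 : ℝ) ^ t = T at *
  -- The term k·T is nonlinear; comparing k with −1, 0, 1, 2 supplies the linear facts needed below.
  have hmul : ∀ a : ℤ, (a ≤ k → (a : ℝ) * T ≤ k * T) ∧ (k ≤ a → (k : ℝ) * T ≤ a * T) := fun a =>
    ⟨fun h => mul_le_mul_of_nonneg_right (by exact_mod_cast h) hT.le,
      fun h => mul_le_mul_of_nonneg_right (by exact_mod_cast h) hT.le⟩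
  have hn := hmul (-1)
  have h00 := hmul 0
  have h11 := hmul 1
  have h22 := hmul 2
  push_cast at hn h00 h11 h22
  rcases hm with hm | hm <;> rw [abs_le] at hm <;> obtain ⟨ha, hb⟩ := hm
  · refine ⟨⟨?_, ?_⟩, ?_⟩
    · rcases le_or_gt 0 k with h | h
      · linarith [h00.1 h]
      · linarith [hn.2 (by omega)]
    · rcases le_or_gt k 0 with h | h
      · linarith [h00.2 h]
      · linarith [h11.1 (by omega)]
    · rcases le_or_gt k 0 with h | h
      · left; linarith [h00.2 h]
      · right; linarith [h11.1 (by omega)]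
  · refine ⟨⟨?_, ?_⟩, ?_⟩
    · rcases le_or_gt k 0 with h | h
      · linarith [h00.2 h]
      · linarith [h11.1 (by omega)]
    · rcases le_or_gt k 1 with h | h
      · linarith [h11.2 h]
      · linarith [h22.1 (by omega)]
    · rcases le_or_gt k 0 with h | h
      · left; linarith [h00.2 h]
      · right; linarith [h11.1 (by omega)]

/-- One run of phase estimation yields an index at distance at most `1` from `2ᵗ θ / π` with
probability at least `7/10`. -/
lemma measure_gridIndex_near_ge {t n : ℕ} (ht : 1 ≤ t) {pPlus pMinus : ℝ}
    (hp : pPlus ∈ Set.Icc (0 : ℝ) 1) (hm : pMinus ∈ Set.Icc (0 : ℝ) 1) (f : Bits n → Fin 2)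
    (x : Bits n) {θ : ℝ} (hθ : smooth pPlus pMinus f x = Real.sin θ ^ 2) (h0 : 0 ≤ θ)
    (h1 : θ ≤ Real.pi / 2) (S : Finset (Bits t))
    (hS : ∀ y, y ∈ S ↔ (2 ^ t : ℕ) * θ / Real.pi - 1 ≤ gridIndex y ∧
      (gridIndex y : ℝ) ≤ (2 ^ t : ℕ) * θ / Real.pi + 1) :
    7 / 10 ≤ (measure f (phaseCircuit t pPlus pMinus x)).toMeasure.real S := by
  have hT2 : 2 ≤ 2 ^ t := by
    calc 2 = 2 ^ 1 := rfl
      _ ≤ 2 ^ t := Nat.pow_le_pow_right (by norm_num) ht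
  set w : ℝ := (2 ^ t : ℕ) * θ / Real.pi with hw
  have hw0 : 0 ≤ w := by have := Real.pi_pos; positivity
  have hw1 : 2 * w ≤ 2 ^ t := by
    rw [hw, ← mul_div_assoc, div_le_iff₀ Real.pi_pos]
    push_cast
    nlinarith [show (0 : ℝ) < 2 ^ t by positivity]
  have hsum : ∀ u : ℝ, (u = w ∨ u = -w) →
      7 / 10 ≤ ∑ y ∈ S, fejer (2 ^ t) (u - value y) := by
    intro u hu
    have := sum_fejer_ge hT2 u (S.map finFunctionFinEquiv.toEmbedding) (by
      intro y m k hy hmu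
      rw [Finset.mem_map_equiv, hS]
      refine gridIndex_near _ hw0 hw1 (m := m) (k := k) ?_ ?_
      · rw [value, Equiv.apply_symm_apply]; exact hy
      · rcases hu with rfl | rfl
        · exact Or.inl hmu
        · exact Or.inr hmu)
    rw [Finset.sum_map] at this
    exact this
  rw [MeasureTheory.measureReal_def, PMF.toMeasure_apply_finset]
  simp only [measure_phaseCircuit_apply hp hm f x hθ]
  rw [← ENNReal.ofReal_sum_of_nonneg fun y _ => by
      have := fejer_nonneg (2 ^ t) (w - value y)
      have := fejer_nonneg (2 ^ t) (-w - value y)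
      positivity,
    ENNReal.toReal_ofReal (Finset.sum_nonneg fun y _ => by
      have := fejer_nonneg (2 ^ t) (w - value y)
      have := fejer_nonneg (2 ^ t) (-w - value y)
      positivity), ← Finset.sum_div, Finset.sum_add_distrib]
  linarith [hsum w (Or.inl rfl), hsum (-w) (Or.inr rfl)]

/-! ### The grid of outputs -/

lemma abs_sin_sq_sub_sin_sq_le (a b : ℝ) : |Real.sin a ^ 2 - Real.sin b ^ 2| ≤ |a - b| := by
  have h : Real.sin a ^ 2 - Real.sin b ^ 2 = Real.sin (a - b) * Real.sin (a + b) := by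
    rw [Real.sin_sub, Real.sin_add]
    linear_combination -Real.sin a ^ 2 * Real.sin_sq_add_cos_sq b
      + Real.sin b ^ 2 * Real.sin_sq_add_cos_sq a
  rw [h, abs_mul]
  exact (mul_le_of_le_one_right (abs_nonneg _) (Real.abs_sin_le_one _)).trans Real.abs_sin_le_abs

/-- Both sin² and the cut-off at 1/2 are 1-Lipschitz, and the cut-off fixes θ/π. -/
lemma gridValue_sub_le {t j : ℕ} {θ : ℝ} (h1 : θ ≤ Real.pi / 2) :
    |gridValue t j - Real.sin θ ^ 2| ≤ Real.pi / 2 ^ t * |j - (2 ^ t : ℕ) * θ / Real.pi| := by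
  have hpi := Real.pi_pos
  have hT : (0 : ℝ) < 2 ^ t := by positivity
  refine (abs_sin_sq_sub_sin_sq_le _ _).trans ?_
  have hθ : θ = Real.pi * min (θ / Real.pi) (1 / 2) := by
    rw [min_eq_left (by rw [div_le_iff₀ hpi]; linarith)]
    field_simp
  conv_lhs => rw [hθ]
  rw [← mul_sub, abs_mul, abs_of_pos hpi]
  calc Real.pi * |min ((j : ℝ) / 2 ^ t) (1 / 2) - min (θ / Real.pi) (1 / 2)|
      ≤ Real.pi * |(j : ℝ) / 2 ^ t - θ / Real.pi| := by
        refine mul_le_mul_of_nonneg_left ?_ hpi.le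
        have h := abs_min_sub_min_le_max ((j : ℝ) / 2 ^ t) (1 / 2) (θ / Real.pi) (1 / 2)
        rwa [sub_self, abs_zero, max_eq_left (abs_nonneg _)] at h
    _ = _ := by
        rw [show (j : ℝ) / 2 ^ t - θ / Real.pi = (j - (2 ^ t : ℕ) * θ / Real.pi) / 2 ^ t by
          push_cast; field_simp, abs_div, abs_of_pos hT]
        ring

lemma gridValue_le {t j : ℕ} {θ : ℝ} (h1 : θ ≤ Real.pi / 2)
    (hj : (j : ℝ) ≤ (2 ^ t : ℕ) * θ / Real.pi) : gridValue t j ≤ Real.sin θ ^ 2 := by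
  have hpi := Real.pi_pos
  have hT : (0 : ℝ) < 2 ^ t := by positivity
  have hle : Real.pi * min ((j : ℝ) / 2 ^ t) (1 / 2) ≤ θ := by
    calc Real.pi * min ((j : ℝ) / 2 ^ t) (1 / 2) ≤ Real.pi * ((j : ℝ) / 2 ^ t) := by
          gcongr; exact min_le_left _ _
      _ ≤ Real.pi * (((2 ^ t : ℕ) * θ / Real.pi) / 2 ^ t) := by gcongr
      _ = θ := by push_cast; field_simp
  have h0 : 0 ≤ Real.pi * min ((j : ℝ) / 2 ^ t) (1 / 2) := by positivity
  exact pow_le_pow_left₀ (Real.sin_nonneg_of_nonneg_of_le_pi h0 (by linarith))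
    (Real.sin_le_sin_of_le_of_le_pi_div_two (by linarith) h1 hle) 2

lemma le_gridValue {t j : ℕ} {θ : ℝ} (h0 : 0 ≤ θ) (h1 : θ ≤ Real.pi / 2)
    (hj : (2 ^ t : ℕ) * θ / Real.pi ≤ j) : Real.sin θ ^ 2 ≤ gridValue t j := by
  have hpi := Real.pi_pos
  have hT : (0 : ℝ) < 2 ^ t := by positivity
  have hle : θ ≤ Real.pi * min ((j : ℝ) / 2 ^ t) (1 / 2) := by
    rw [← div_le_iff₀' hpi, le_min_iff]
    constructor
    · calc θ / Real.pi = ((2 ^ t : ℕ) * θ / Real.pi) / 2 ^ t := by push_cast; field_simp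
        _ ≤ _ := by gcongr
    · rw [div_le_iff₀ hpi]; linarith
  refine pow_le_pow_left₀ (Real.sin_nonneg_of_nonneg_of_le_pi h0 (by linarith))
    (Real.sin_le_sin_of_le_of_le_pi_div_two (by linarith) ?_ hle) 2
  calc Real.pi * min ((j : ℝ) / 2 ^ t) (1 / 2) ≤ Real.pi * (1 / 2) := by
        gcongr; exact min_le_right _ _
    _ = _ := by ring

lemma smooth_mem_Icc {n : ℕ} {pPlus pMinus : ℝ} (hp : pPlus ∈ Set.Icc (0 : ℝ) 1)
    (hm : pMinus ∈ Set.Icc (0 : ℝ) 1) (f : Bits n → Fin 2) (x : Bits n) :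
    smooth pPlus pMinus f x ∈ Set.Icc (0 : ℝ) 1 := by
  have h : ∀ b, 0 ≤ transProb pPlus pMinus x b := fun b => by
    rw [← norm_loaded_sq hp hm]; positivity
  refine ⟨Finset.sum_nonneg fun b _ => h b, ?_⟩
  rw [← sum_norm_loaded_sq pPlus pMinus x]
  simp only [norm_loaded_sq hp hm]
  exact Finset.sum_le_sum_of_subset_of_nonneg (Finset.filter_subset _ _) fun b _ _ => h b

/-! ### The number of counting qubits and of oracle calls -/

/-- A number of counting qubits that suffices for the accuracy `ε`. -/
noncomputable def countingQubits (ε : ℝ) : ℕ := Nat.clog 2 ⌈7 / ε⌉₊ + 1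

/-- The logarithm alone gives 2^t ≥ 7/ε > 2π/ε. The extra qubit in `countingQubits` guarantees t ≥ 1
even for large ε, as the two distinct residues require. -/
lemma two_pi_div_lt {ε : ℝ} (hε : 0 < ε) : Real.pi / 2 ^ countingQubits ε * 2 < ε := by
  have h1 : 7 / ε ≤ 2 ^ Nat.clog 2 ⌈7 / ε⌉₊ := (Nat.le_ceil _).trans (by
    exact_mod_cast Nat.le_pow_clog (by norm_num) _)
  have h2 : (7 : ℝ) ≤ 2 ^ Nat.clog 2 ⌈7 / ε⌉₊ * ε := (div_le_iff₀ hε).1 h1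
  rw [div_mul_eq_mul_div, div_lt_iff₀ (by positivity), countingQubits, pow_succ]
  have := Real.pi_lt_d2
  nlinarith

/-- Minimality of the logarithm gives 2^t ≤ 4⌈7/ε⌉ ≤ 4(7/ε + 1), and 1 ≤ 1/ε absorbs the rounding.
-/
lemma two_pow_countingQubits_le {ε : ℝ} (hε : ε ∈ Set.Ioc (0 : ℝ) 1) :
    (2 : ℝ) ^ countingQubits ε ≤ 32 * (1 / ε) := by
  have h7 : 7 ≤ 7 / ε := by rw [le_div_iff₀ hε.1]; linarith [hε.2]
  have hc : 1 < ⌈7 / ε⌉₊ := by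
    rw [Nat.lt_ceil]; push_cast; linarith
  have hlog := Nat.pow_pred_clog_lt_self (b := 2) (by norm_num) hc
  have hpos : 0 < Nat.clog 2 ⌈7 / ε⌉₊ := Nat.clog_pos (by norm_num) hc
  have hlog' : (2 : ℝ) ^ (Nat.clog 2 ⌈7 / ε⌉₊ - 1) ≤ ⌈7 / ε⌉₊ := by
    exact_mod_cast hlog.le
  have hceil := (Nat.ceil_lt_add_one (by linarith : 0 ≤ 7 / ε)).le
  have h1 : 1 ≤ 1 / ε := by rw [le_div_iff₀ hε.1]; linarith [hε.2]
  have e : countingQubits ε = (Nat.clog 2 ⌈7 / ε⌉₊ - 1) + 2 := by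
    unfold countingQubits; omega
  rw [e, pow_add]
  have : 7 / ε = 7 * (1 / ε) := by ring
  linarith

lemma circuitCalls_phaseCircuit {t n : ℕ} (pPlus pMinus : ℝ) (x : Bits n) :
    circuitCalls (phaseCircuit t pPlus pMinus x) = 2 ^ t - 1 := by
  have happ : ∀ C D : List (Gate t n), circuitCalls (C ++ D) = circuitCalls C + circuitCalls D :=
    fun C D => by simp [circuitCalls]
  have hrep : ∀ (k : Fin t) (m : ℕ), circuitCalls (List.replicate m
      [Gate.query k, Gate.free (controlled k (reflPsi pPlus pMinus x))]).flatten = m := by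
    intro k m
    induction m with
    | zero => rfl
    | succ m ih =>
      rw [List.replicate_succ, List.flatten_cons, happ, ih]
      simp [circuitCalls, Gate.calls, add_comm]
  have hflat : ∀ l : List (Fin t), circuitCalls (l.flatMap fun k : Fin t =>
      (List.replicate (2 ^ (k : ℕ))
        [Gate.query k, Gate.free (controlled k (reflPsi pPlus pMinus x))]).flatten)
      = (l.map fun k : Fin t => 2 ^ (k : ℕ)).sum := by
    intro l
    induction l with
    | nil => rfl
    | cons k l ih => rw [List.flatMap_cons, happ, ih, hrep, List.map_cons, List.sum_cons]
  rw [phaseCircuit, happ, happ, hflat, ← Fin.sum_univ_def,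
    Fin.sum_univ_eq_sum_range (fun k => 2 ^ k), Nat.geomSum_eq le_rfl]
  simp [circuitCalls, Gate.calls]

/-- Rounding up the repetitions costs at most 1 ≤ ln(1/δ)/ln(1/δ₀); this is where δ₀ must stay away
from 1. -/
lemma totalCalls_le {n : ℕ} (x : Bits n) (pPlus pMinus : ℝ) {ε δ δ₀ : ℝ}
    (hε : ε ∈ Set.Ioc (0 : ℝ) 1) (hδ : δ ∈ Set.Ioc (0 : ℝ) δ₀) (hδ₀ : δ₀ < 1) :
    (totalCalls (countingQubits ε) δ pPlus pMinus x : ℝ)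
      ≤ (17 + 1 / Real.log (1 / δ₀)) * 32 * (Real.log (1 / δ) * (1 / ε)) := by
  have hδ₀0 : 0 < δ₀ := hδ.1.trans_le hδ.2
  have hL₀ : 0 < Real.log (1 / δ₀) := Real.log_pos (by rw [lt_div_iff₀ hδ₀0]; linarith)
  have hLL : Real.log (1 / δ₀) ≤ Real.log (1 / δ) :=
    Real.log_le_log (by positivity) (one_div_le_one_div_of_le hδ.1 hδ.2)
  have hreps : (reps δ : ℝ) ≤ (17 + 1 / Real.log (1 / δ₀)) * Real.log (1 / δ) := by
    have h1 := (Nat.ceil_lt_add_one (by linarith : 0 ≤ 17 * Real.log (1 / δ))).le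
    have h2 : 1 ≤ 1 / Real.log (1 / δ₀) * Real.log (1 / δ) := by
      rw [one_div_mul_eq_div, le_div_iff₀ hL₀]; linarith
    unfold reps
    linarith
  have hcalls : (circuitCalls (phaseCircuit (countingQubits ε) pPlus pMinus x) : ℝ)
      ≤ 32 * (1 / ε) := by
    rw [circuitCalls_phaseCircuit]
    refine le_trans ?_ (two_pow_countingQubits_le hε)
    exact_mod_cast Nat.sub_le _ _
  rw [totalCalls, Nat.cast_mul]
  calc (reps δ : ℝ) * (circuitCalls (phaseCircuit (countingQubits ε) pPlus pMinus x) : ℝ)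
      ≤ ((17 + 1 / Real.log (1 / δ₀)) * Real.log (1 / δ)) * (32 * (1 / ε)) := by
        have : 0 ≤ Real.log (1 / δ) := hL₀.le.trans hLL
        gcongr
    _ = _ := by ring

/-- The guarantees for `g(x)` that the algorithm returns with high probability. -/
lemma bounds_of_medianIndex {N t : ℕ} (ω : Fin N → Bits t) {θ ε : ℝ} (h0 : 0 ≤ θ)
    (h1 : θ ≤ Real.pi / 2) (ht : Real.pi / 2 ^ t * 2 < ε)
    (hlo : (2 ^ t : ℕ) * θ / Real.pi - 1 ≤ medianIndex ω)
    (hhi : (medianIndex ω : ℝ) ≤ (2 ^ t : ℕ) * θ / Real.pi + 1) :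
    |estimate ω - Real.sin θ ^ 2| < ε ∧ lowerBound ω ≤ Real.sin θ ^ 2 ∧
      |lowerBound ω - Real.sin θ ^ 2| < ε ∧ Real.sin θ ^ 2 ≤ upperBound ω ∧
      |upperBound ω - Real.sin θ ^ 2| < ε := by
  have hclose : ∀ j : ℕ, |(j : ℝ) - (2 ^ t : ℕ) * θ / Real.pi| ≤ 2 →
      |gridValue t j - Real.sin θ ^ 2| < ε := fun j hj =>
    ((gridValue_sub_le h1).trans (mul_le_mul_of_nonneg_left hj
      (div_nonneg Real.pi_pos.le (by positivity)))).trans_lt ht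
  have hw0 : 0 ≤ (2 ^ t : ℕ) * θ / Real.pi := by have := Real.pi_pos; positivity
  unfold estimate lowerBound upperBound
  generalize medianIndex ω = i at *
  -- For i = 0 the truncated subtraction returns index 0, matching the convention for the lower
  -- bound; w ≥ 0 then suffices.
  have hpred : ((i - 1 : ℕ) : ℝ) ≤ (2 ^ t : ℕ) * θ / Real.pi ∧
      (2 ^ t : ℕ) * θ / Real.pi - 2 ≤ ((i - 1 : ℕ) : ℝ) := by
    rcases Nat.eq_zero_or_pos i with rfl | hi
    · simp only [Nat.zero_sub, Nat.cast_zero] at *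
      exact ⟨hw0, by linarith⟩
    · rw [Nat.cast_pred hi]
      constructor <;> linarith
  refine ⟨hclose _ ?_, gridValue_le h1 hpred.1, hclose _ ?_,
    le_gridValue h0 h1 ?_, hclose _ ?_⟩
  · rw [abs_le]; constructor <;> linarith
  · rw [abs_le]; constructor <;> linarith [hpred.1, hpred.2]
  · push_cast at hlo ⊢; linarith
  · rw [abs_le]; push_cast at hlo hhi ⊢; constructor <;> linarith

lemma one_sub_le_runs {n : ℕ} (f : Bits n → Fin 2) (x : Bits n) {pPlus pMinus ε δ : ℝ}
    (hp : pPlus ∈ Set.Icc (0 : ℝ) 1) (hm : pMinus ∈ Set.Icc (0 : ℝ) 1) (hε : 0 < ε)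
    (hδ : δ ∈ Set.Ioo (0 : ℝ) 1) :
    1 - δ ≤ (runs (countingQubits ε) δ pPlus pMinus f x).real
      {ω | |estimate ω - smooth pPlus pMinus f x| < ε ∧
        lowerBound ω ≤ smooth pPlus pMinus f x ∧
        |lowerBound ω - smooth pPlus pMinus f x| < ε ∧
        smooth pPlus pMinus f x ≤ upperBound ω ∧
        |upperBound ω - smooth pPlus pMinus f x| < ε} := by
  classical
  obtain ⟨hg0, hg1⟩ := smooth_mem_Icc hp hm f x
  set θ := Real.arcsin (Real.sqrt (smooth pPlus pMinus f x)) with hθdef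
  have hθ : smooth pPlus pMinus f x = Real.sin θ ^ 2 := by
    rw [hθdef, Real.sin_arcsin (by linarith [Real.sqrt_nonneg (smooth pPlus pMinus f x)])
      (Real.sqrt_le_one.2 hg1), Real.sq_sqrt hg0]
  have h0 : 0 ≤ θ := Real.arcsin_nonneg.2 (Real.sqrt_nonneg _)
  have h1 : θ ≤ Real.pi / 2 := Real.arcsin_le_pi_div_two _
  set t := countingQubits ε with ht
  set w : ℝ := (2 ^ t : ℕ) * θ / Real.pi with hw
  set S : Finset (Bits t) := Finset.univ.filter fun y =>
    w - 1 ≤ gridIndex y ∧ (gridIndex y : ℝ) ≤ w + 1 with hSdef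
  have hS : ∀ y, y ∈ S ↔ w - 1 ≤ gridIndex y ∧ (gridIndex y : ℝ) ≤ w + 1 := by simp [hSdef]
  have hprob := measure_gridIndex_near_ge (t := t) (Nat.succ_le_succ (Nat.zero_le _))
    hp hm f x hθ h0 h1 S hS
  have hfail := (measureReal_majority_fail_le _ (reps δ) S hprob).trans (pow_reps_le hδ)
  set bad : Set (Fin (reps δ) → Bits t) :=
    {ω | ∃ J : Finset (Fin (reps δ)), reps δ ≤ 2 * J.card ∧ ∀ i ∈ J, ω i ∉ S} with hbad
  have : MeasureTheory.IsProbabilityMeasure (runs t δ pPlus pMinus f x) := by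
    unfold runs; infer_instance
  have hcompl := MeasureTheory.probReal_compl_eq_one_sub
    (μ := runs t δ pPlus pMinus f x) bad.toFinite.measurableSet
  have hle : 1 - δ ≤ (runs t δ pPlus pMinus f x).real badᶜ := by
    rw [hcompl]
    exact sub_le_sub_left hfail 1
  refine hle.trans (MeasureTheory.measureReal_mono fun ω hω => ?_)
  have hmed : w - 1 ≤ medianIndex ω ∧ (medianIndex ω : ℝ) ≤ w + 1 := by
    by_contra hcon
    refine hω ⟨_, le_two_mul_card_of_median (reps_pos hδ) _ _ _ hcon, fun i hi => ?_⟩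
    rw [hS]
    exact (Finset.mem_filter.1 hi).2
  rw [Set.mem_ofPred_eq, hθ]
  exact bounds_of_medianIndex ω h0 h1 (two_pi_div_lt hε) hmed.1 hmed.2

end SQC

theorem mainTheorem2 :
    ∃ t : ℝ → ℕ,
      (∀ (n : ℕ) (f : SQC.Bits n → Fin 2) (x : SQC.Bits n) (pPlus pMinus ε δ : ℝ),
        pPlus ∈ Set.Icc (0 : ℝ) 1 → pMinus ∈ Set.Icc (0 : ℝ) 1 → 0 < ε → δ ∈ Set.Ioo (0 : ℝ) 1 →
        1 - δ ≤ (SQC.runs (t ε) δ pPlus pMinus f x).real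
          {ω | |SQC.estimate ω - SQC.smooth pPlus pMinus f x| < ε ∧
            SQC.lowerBound ω ≤ SQC.smooth pPlus pMinus f x ∧
            |SQC.lowerBound ω - SQC.smooth pPlus pMinus f x| < ε ∧
            SQC.smooth pPlus pMinus f x ≤ SQC.upperBound ω ∧
            |SQC.upperBound ω - SQC.smooth pPlus pMinus f x| < ε}) ∧
      (∀ δ₀ : ℝ, δ₀ < 1 → ∃ C : ℝ,
        ∀ (n : ℕ) (x : SQC.Bits n) (pPlus pMinus ε δ : ℝ),
          pPlus ∈ Set.Icc (0 : ℝ) 1 → pMinus ∈ Set.Icc (0 : ℝ) 1 →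
          ε ∈ Set.Ioc (0 : ℝ) 1 → δ ∈ Set.Ioc (0 : ℝ) δ₀ →
          (SQC.totalCalls (t ε) δ pPlus pMinus x : ℝ) ≤ C * (Real.log (1 / δ) * (1 / ε))) :=
  ⟨SQC.countingQubits, fun _ f x _ _ _ _ hp hm hε hδ => SQC.one_sub_le_runs f x hp hm hε hδ,
    fun _ hδ₀ => ⟨_, fun _ x pPlus pMinus _ _ _ _ hε hδ =>
      SQC.totalCalls_le x pPlus pMinus hε hδ hδ₀⟩⟩
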